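/- Let $k$ be a field, $N \ge 0$, and let $M$ be a coherent sheaf on $\mathbb{P}^N = \mathbb{P}^N_k$ which is Castelnuovo–Mumford regular, i.e. $H^i(\mathbb{P}^N, M(-i)) = 0$ for all $i > 0$. Let $d \ge 1$ be an integer, let $V \subset H^0(\mathbb{P}^N, M(d))$ be a $k$-subspace of codimension $c$, and let \[V^{d+1} = \mu\bigl(V \otimes H^0(\mathcal{O}_{\mathbb{P}^N}(1))\bigr) \subset H^0(\mathbb{P}^N, M(d+1)),\] where $\mu$ is the multiplication map. Then \[\operatorname{codim} V^{d+1} \le c^{<d>}.\] Here $0^{<d>} = 0$, and for $c \ge 1$ we put $c^{<d>} = \sum_{i=f}^{d} \binom{k_i+1}{i+1}$, where $c = \sum_{i=f}^{d} \binom{k_i}{i}$ is the unique expression of $c$ with $1 \le f \le d$ and $k_d > k_{d-1} > \dots > k_f \ge f$. -/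

import Mathlib

universe u

namespace CMReg

open CategoryTheory AlgebraicGeometry TopologicalSpace Opposite

noncomputable section

section Twist

variable {X : Scheme.{u}}

/-- Restriction of functions. -/
def resO {U V : X.Opens} (h : V ≤ U) : Γ(X, U) →+* Γ(X, V) :=
  (X.presheaf.map (homOfLE h).op).hom

/-- Restriction of sections of an `𝒪_X`-module. -/
def res (M : X.Modules) {U V : X.Opens} (h : V ≤ U) : Γ(M, U) →+ Γ(M, V) :=
  (M.presheaf.map (homOfLE h).op).hom

theorem resO_resO {U V W : X.Opens} (h : V ≤ U) (h' : W ≤ V) (r : Γ(X, U)) :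
    resO h' (resO h r) = resO (h'.trans h) r := by
  simp only [resO, ← CommRingCat.comp_apply, ← Functor.map_comp]
  rfl

theorem res_res (M : X.Modules) {U V W : X.Opens} (h : V ≤ U) (h' : W ≤ V) (s : Γ(M, U)) :
    res M h' (res M h s) = res M (h'.trans h) s := by
  simp only [res, ← AddCommGrpCat.comp_apply, ← Functor.map_comp]
  rfl

theorem res_smul (M : X.Modules) {U V : X.Opens} (h : V ≤ U) (r : Γ(X, U)) (s : Γ(M, U)) :
    res M h (r • s) = resO h r • res M h s :=
  M.map_smul (homOfLE h) r s

theorem res_self (M : X.Modules) {U : X.Opens} (h : U ≤ U) (s : Γ(M, U)) : res M h s = s := by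
  have : (homOfLE h).op = 𝟙 (op U) := rfl
  simp only [res, this, CategoryTheory.Functor.map_id]
  rfl

variable {ι : Type} (D : ι → X.Opens) (g : ∀ i j, Γ(X, D i ⊓ D j))

theorem le_left (U : X.Opens) (i j : ι) : U ⊓ (D i ⊓ D j) ≤ U ⊓ D i :=
  inf_le_inf_left U inf_le_left

theorem le_right (U : X.Opens) (i j : ι) : U ⊓ (D i ⊓ D j) ≤ U ⊓ D j :=
  inf_le_inf_left U inf_le_right

/-- The transition function `g i j`, restricted to `U ∩ D i ∩ D j`. -/
def transOn (U : X.Opens) (i j : ι) : Γ(X, U ⊓ (D i ⊓ D j)) := resO inf_le_right (g i j)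

/-- A family of sections `s i ∈ M(U ∩ D i)` with `s j = g i j • s i` on `U ∩ D i ∩ D j`. -/
def IsTwistFamily (M : X.Modules) (U : X.Opens) (s : ∀ i, Γ(M, U ⊓ D i)) : Prop :=
  ∀ i j, res M (le_right D U i j) (s j) = transOn D g U i j • res M (le_left D U i j) (s i)

/-- The sections over `U` of the twist of `M` by the transition functions `g i j`: the families
`s i ∈ M(U ∩ D i)` with `s j = g i j • s i` on the overlaps. -/
def twistSections (M : X.Modules) (U : X.Opens) : AddSubgroup (∀ i, Γ(M, U ⊓ D i)) where
  carrier := {s | IsTwistFamily D g M U s}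
  add_mem' {s t} hs ht i j := by
    have hs := hs i j
    have ht := ht i j
    change res M _ (s j + t j) = transOn D g U i j • res M _ (s i + t i)
    rw [map_add, map_add, hs, ht]
    exact (smul_add _ _ _).symm
  zero_mem' i j := by
    change res M _ 0 = transOn D g U i j • res M _ 0
    rw [map_zero, map_zero]
    exact (smul_zero _).symm
  neg_mem' {s} hs i j := by
    have hs := hs i j
    change res M _ (-s j) = transOn D g U i j • res M _ (-s i)
    rw [map_neg, map_neg, hs]
    exact (smul_neg _ _).symm

theorem res_trans {U V : X.Opens} (h : V ≤ U) (i j : ι) :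
    resO (inf_le_inf_right (D i ⊓ D j) h) (transOn D g U i j) = transOn D g V i j :=
  resO_resO _ _ _

theorem mem_twistSections {M : X.Modules} {U : X.Opens} {s : ∀ i, Γ(M, U ⊓ D i)} :
    s ∈ twistSections D g M U ↔ IsTwistFamily D g M U s :=
  Iff.rfl

theorem twist_ext {M : X.Modules} {U : X.Opens} {s t : twistSections D g M U}
    (h : ∀ i, s.1 i = t.1 i) : s = t :=
  Subtype.ext (funext h)

instance (M : X.Modules) (U : X.Opens) : Module Γ(X, U) (twistSections D g M U) where
  smul r s := ⟨fun i ↦ (resO inf_le_left r : Γ(X, U ⊓ D i)) • s.1 i,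
    (mem_twistSections D g).2 fun i j ↦ by
      rw [res_smul, res_smul, (mem_twistSections D g).1 s.2 i j, resO_resO, resO_resO,
        smul_smul, smul_smul, mul_comm]⟩
  one_smul s := twist_ext D g fun i ↦ by
    change (resO _ 1 : Γ(X, _)) • s.1 i = _
    rw [map_one, one_smul]
  mul_smul a b s := twist_ext D g fun i ↦ by
    change (resO inf_le_left (a * b) : Γ(X, U ⊓ D i)) • s.1 i =
      (resO inf_le_left a : Γ(X, U ⊓ D i)) • (resO inf_le_left b : Γ(X, U ⊓ D i)) • s.1 i
    rw [map_mul, mul_smul]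
  smul_zero a := twist_ext D g fun i ↦ smul_zero (resO inf_le_left a : Γ(X, U ⊓ D i))
  smul_add a s t := twist_ext D g fun i ↦
    smul_add (resO inf_le_left a : Γ(X, U ⊓ D i)) (s.1 i) (t.1 i)
  add_smul a b s := twist_ext D g fun i ↦ by
    change (resO inf_le_left (a + b) : Γ(X, U ⊓ D i)) • s.1 i =
      (resO inf_le_left a : Γ(X, U ⊓ D i)) • s.1 i + (resO inf_le_left b : Γ(X, U ⊓ D i)) • s.1 i
    rw [map_add, add_smul]
  zero_smul s := twist_ext D g fun i ↦ by
    change (resO _ 0 : Γ(X, _)) • s.1 i = 0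
    rw [map_zero, zero_smul]

theorem smul_val (M : X.Modules) (U : X.Opens) (r : Γ(X, U)) (s : twistSections D g M U) (i : ι) :
    (r • s).1 i = (resO inf_le_left r : Γ(X, U ⊓ D i)) • s.1 i := rfl

/-- Restriction of sections of the twist. -/
def twistRes (M : X.Modules) {U V : X.Opens} (h : V ≤ U) :
    twistSections D g M U →+ twistSections D g M V where
  toFun s := ⟨fun i ↦ res M (inf_le_inf_right (D i) h) (s.1 i), (mem_twistSections D g).2 fun i j ↦ by
    have := congrArg (res M (inf_le_inf_right (D i ⊓ D j) h)) ((mem_twistSections D g).1 s.2 i j)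
    rw [res_smul, res_res, res_res, res_trans D g h] at this
    rw [res_res, res_res]
    exact this⟩
  map_zero' := twist_ext D g fun i ↦ map_zero _
  map_add' s t := twist_ext D g fun i ↦ map_add _ _ _

theorem twistRes_smul (M : X.Modules) {U V : X.Opens} (h : V ≤ U) (r : Γ(X, U))
    (s : twistSections D g M U) :
    twistRes D g M h (r • s) = resO h r • twistRes D g M h s :=
  twist_ext D g fun i ↦ by
    change res M _ ((resO inf_le_left r : Γ(X, U ⊓ D i)) • s.1 i) =
      (resO inf_le_left (resO h r) : Γ(X, V ⊓ D i)) • res M _ (s.1 i)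
    rw [res_smul, resO_resO, resO_resO]

/-- The twist of `M`, as a presheaf of abelian groups. -/
def twistPresheaf (M : X.Modules) : TopCat.Presheaf Ab X where
  obj U := AddCommGrpCat.of (twistSections D g M U.unop)
  map f := AddCommGrpCat.ofHom (twistRes D g M f.unop.le)
  map_id U := by
    ext s
    exact res_self M _ (s.1 _)
  map_comp f f' := by
    ext s
    exact (res_res M _ _ (s.1 _)).symm

theorem twistPresheaf_isSheaf (M : X.Modules) : (twistPresheaf D g M).IsSheaf := by
  rw [TopCat.Presheaf.isSheaf_iff_isSheafUniqueGluing]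
  intro κ V sf hsf
  let F : TopCat.Sheaf Ab X := ⟨M.presheaf, M.isSheaf⟩
  have hsf' : ∀ (a b : κ) (i : ι),
      res M (inf_le_inf_right (D i) inf_le_left : V a ⊓ V b ⊓ D i ≤ V a ⊓ D i) ((sf a).1 i) =
      res M (inf_le_inf_right (D i) inf_le_right) ((sf b).1 i) := fun a b i ↦
    congrFun (congrArg Subtype.val (hsf a b)) i
  -- glue each component
  have hle : ∀ (i : ι) (a : κ), V a ⊓ D i ≤ iSup V ⊓ D i := fun i a ↦
    inf_le_inf_right _ (le_iSup V a)
  have glue : ∀ i, ∃! s : Γ(M, iSup V ⊓ D i), ∀ a, res M (hle i a) s = (sf a).1 i := by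
    intro i
    refine F.existsUnique_gluing' (fun a ↦ V a ⊓ D i) (iSup V ⊓ D i) (fun a ↦ homOfLE (hle i a))
      (by rw [iSup_inf_eq]) (fun a ↦ (sf a).1 i) ?_
    intro a b
    have h := congrArg (res M (U := V a ⊓ V b ⊓ D i) (V := V a ⊓ D i ⊓ (V b ⊓ D i))
      (le_inf (inf_le_inf inf_le_left inf_le_left) (inf_le_left.trans inf_le_right)))
      (hsf' a b i)
    rw [res_res, res_res] at h
    exact h
  choose s hs hu using glue
  refine ⟨⟨s, (mem_twistSections D g).2 fun i j ↦ ?_⟩, fun a ↦ twist_ext D g fun i ↦ hs i a, ?_⟩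
  · refine F.eq_of_locally_eq' (fun a ↦ V a ⊓ (D i ⊓ D j)) _
      (fun a ↦ homOfLE (inf_le_inf_right _ (le_iSup V a))) (by rw [iSup_inf_eq]) _ _ fun a ↦ ?_
    have h := (mem_twistSections D g).1 (sf a).2 i j
    rw [← hs i a, ← hs j a, res_res, res_res] at h
    change res M _ _ = res M _ _
    rw [res_smul, res_res, res_res, res_trans D g (le_iSup V a)]
    exact h
  · intro t ht
    refine twist_ext D g fun i ↦ hu i (t.1 i) fun a ↦ ?_
    exact congrFun (congrArg Subtype.val (ht a)) i

instance (M : X.Modules) (U : X.Opensᵒᵖ) :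
    Module (X.ringCatSheaf.obj.obj U) ((twistPresheaf D g M).obj U) :=
  inferInstanceAs (Module Γ(X, U.unop) (twistSections D g M U.unop))

/-- The `𝒪_X`-module obtained by gluing the restrictions `M|_{D i}` along the transition functions
`g i j`. If the `D i` cover `X` and the `g i j` are a cocycle of units, this is `M ⊗ L`, where `L` is
the invertible sheaf with local generators `e i` on `D i` and `e i = g i j • e j`; the
family `s i` stands for the section which is `s i ⊗ e i` on `D i`. -/
def twistBy (M : X.Modules) : X.Modules where
  val := PresheafOfModules.ofPresheaf (R := X.ringCatSheaf.obj) (twistPresheaf D g M)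
    fun _ _ f r s ↦ twistRes_smul D g M f.unop.le r s
  isSheaf := twistPresheaf_isSheaf D g M

/-- A section over `U` of the `𝒪_X`-module `𝒪_X` is a function on `U`. -/
def unitToFun {U : X.Opens} (t : Γ((SheafOfModules.unit X.ringCatSheaf : X.Modules), U)) : Γ(X, U) := t

variable {g}

/-- The product `(s i) · (t i) = (t i • s i)` of a section of the twist of `M` by `g` with a section of
the twist of `𝒪_X` by `g'` is a section of the twist of `M` by `g * g'`. -/
def twistMul {g' g'' : ∀ i j, Γ(X, D i ⊓ D j)} (h : ∀ i j, g'' i j = g i j * g' i j)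
    {M : X.Modules} {U : X.Opens} (s : twistSections D g M U)
    (t : twistSections D g' (SheafOfModules.unit X.ringCatSheaf : X.Modules) U) :
    twistSections D g'' M U :=
  ⟨fun i ↦ unitToFun (t.1 i) • s.1 i, (mem_twistSections D g'').2 fun i j ↦ by
    have ht : resO (le_right D U i j) (unitToFun (t.1 j)) =
        transOn D g' U i j * resO (le_left D U i j) (unitToFun (t.1 i)) :=
      (mem_twistSections D g').1 t.2 i j
    have hg : transOn D g'' U i j = transOn D g U i j * transOn D g' U i j := by
      rw [transOn, h, map_mul]; rfl
    rw [res_smul, res_smul, (mem_twistSections D g).1 s.2 i j, ht, hg, smul_smul, smul_smul]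
    congr 1
    ring⟩

end Twist

section ProjectiveSpace

variable (k : Type u) [Field k] (N : ℕ)

/-- The grading of `k[x_0, …, x_N]` by degree. -/
abbrev grading : ℕ → Submodule k (MvPolynomial (Fin (N + 1)) k) :=
  MvPolynomial.homogeneousSubmodule (Fin (N + 1)) k

instance : GradedAlgebra (grading k N) := MvPolynomial.gradedAlgebra

/-- The projective space `ℙ^N = Proj k[x_0, …, x_N]` over `k`. -/
abbrev ProjSpace : Scheme.{u} := Proj (grading k N)

/-- The standard affine open subset `D₊(x_i)` of `ℙ^N`. -/
def chart (i : Fin (N + 1)) : (ProjSpace k N).Opens :=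
  Proj.basicOpen (grading k N) (MvPolynomial.X i)

theorem X_mem (i : Fin (N + 1)) :
    (MvPolynomial.X i : MvPolynomial (Fin (N + 1)) k) ∈ grading k N 1 :=
  MvPolynomial.isHomogeneous_X k i

/-- The function `x_i / x_j` on `D₊(x_j)`. -/
def ratio (i j : Fin (N + 1)) : Γ(ProjSpace k N, chart k N j) :=
  Proj.awayToSection (grading k N) (MvPolynomial.X j)
    (HomogeneousLocalization.Away.mk (grading k N) (X_mem k N j) 1 (MvPolynomial.X i)
      (X_mem k N i))

theorem mk_mul_mk_swap {A : Type*} [CommRing A] (S : Submonoid A) {a b : A} (ha : a ∈ S)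
    (hb : b ∈ S) :
    (Localization.mk a ⟨b ^ 1, pow_mem hb 1⟩ * Localization.mk b ⟨a ^ 1, pow_mem ha 1⟩ :
      Localization S) = 1 := by
  rw [Localization.mk_mul, ← Localization.mk_one, Localization.mk_eq_mk_iff,
    Localization.r_iff_exists]
  exact ⟨1, by simp [mul_comm]⟩

theorem ratio_mul_ratio (i j : Fin (N + 1)) :
    (resO inf_le_right (ratio k N i j) : Γ(ProjSpace k N, chart k N i ⊓ chart k N j)) *
      resO inf_le_left (ratio k N j i) = 1 := by
  apply Subtype.ext
  funext x
  apply HomogeneousLocalization.val_injective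
  let y : ProjectiveSpectrum (grading k N) := x.1
  have : y.asHomogeneousIdeal.toIdeal.IsPrime := y.isPrime
  have h := mk_mul_mk_swap (y.asHomogeneousIdeal.toIdeal.primeCompl) x.2.1 x.2.2
  refine Eq.trans (Eq.trans ?_ h) (HomogeneousLocalization.val_one (𝒜 := grading k N)
    (x := y.asHomogeneousIdeal.toIdeal.primeCompl)).symm
  refine (HomogeneousLocalization.val_mul (𝒜 := grading k N)
    (x := y.asHomogeneousIdeal.toIdeal.primeCompl) _ _).trans ?_
  congr 1

theorem ratio_mul_ratio' (i j : Fin (N + 1)) :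
    (resO inf_le_left (ratio k N j i) : Γ(ProjSpace k N, chart k N i ⊓ chart k N j)) *
      resO inf_le_right (ratio k N i j) = 1 := by
  rw [mul_comm, ratio_mul_ratio]

/-- The function `x_i / x_j` as a unit on `D₊(x_i) ∩ D₊(x_j)`. -/
def ratioUnit (i j : Fin (N + 1)) : Γ(ProjSpace k N, chart k N i ⊓ chart k N j)ˣ where
  val := resO inf_le_right (ratio k N i j)
  inv := resO inf_le_left (ratio k N j i)
  val_inv := ratio_mul_ratio k N i j
  inv_val := ratio_mul_ratio' k N i j

/-- The transition functions `(x_i / x_j) ^ n` of `𝒪(n)`, for `n : ℤ`. -/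
def transition (n : ℤ) (i j : Fin (N + 1)) : Γ(ProjSpace k N, chart k N i ⊓ chart k N j) :=
  ((ratioUnit k N i j ^ n : Γ(ProjSpace k N, chart k N i ⊓ chart k N j)ˣ) :
    Γ(ProjSpace k N, chart k N i ⊓ chart k N j))

theorem transition_add (a b : ℤ) (i j : Fin (N + 1)) :
    transition k N (a + b) i j = transition k N a i j * transition k N b i j := by
  rw [transition, zpow_add, Units.val_mul]; rfl

variable {k N}

/-- The Serre twist `M(n)` of an `𝒪`-module `M` on `ℙ^N`: the sheaf glued from the restrictions of `M`
to the `D₊(x_i)` by `(x_i / x_j) ^ n`. The family `s i` stands for the section which is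
`s i ⊗ x_i ^ n` on `D₊(x_i)`. -/
def serreTwist (M : (ProjSpace k N).Modules) (n : ℤ) : (ProjSpace k N).Modules :=
  twistBy (chart k N) (transition k N n) M

variable (k N)

/-- The structure sheaf of `ℙ^N` as a module over itself. -/
abbrev structureModule : (ProjSpace k N).Modules := SheafOfModules.unit (ProjSpace k N).ringCatSheaf

/-- The sheaf `𝒪(n)` on `ℙ^N`. -/
def sheafO (n : ℤ) : (ProjSpace k N).Modules := serreTwist (structureModule k N) n

/-- The constants `k → Γ(ℙ^N, 𝒪)`. -/
def constants : k →+* Γ(ProjSpace k N, ⊤) :=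
  (resO (Proj.basicOpen_one (grading k N)).ge).comp <|
    (Proj.awayToSection (grading k N) 1).hom.comp <|
      (HomogeneousLocalization.fromZeroRingHom (grading k N) (Submonoid.powers 1)).comp <|
        algebraMap k (grading k N 0)

variable {k N}

/-- The space of global sections `H^0(F)` of an `𝒪`-module on `ℙ^N`. -/
def H0 (F : (ProjSpace k N).Modules) : Type u := Γ(F, ⊤)

instance (F : (ProjSpace k N).Modules) : AddCommGroup (H0 F) :=
  inferInstanceAs (AddCommGroup Γ(F, ⊤))

instance (F : (ProjSpace k N).Modules) : Module Γ(ProjSpace k N, ⊤) (H0 F) :=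
  inferInstanceAs (Module Γ(ProjSpace k N, ⊤) Γ(F, ⊤))

/-- `H^0(F)` is a `k`-vector space, through the constants. -/
instance (F : (ProjSpace k N).Modules) : Module k (H0 F) :=
  Module.compHom (H0 F) (constants k N)

theorem smul_val_H0 (M : (ProjSpace k N).Modules) (n : ℤ) (c : k) (s : H0 (serreTwist M n))
    (i : Fin (N + 1)) :
    (show twistSections (chart k N) (transition k N n) M ⊤ from c • s).1 i =
      (resO inf_le_left (constants k N c) : Γ(ProjSpace k N, ⊤ ⊓ chart k N i)) •
        (show twistSections (chart k N) (transition k N n) M ⊤ from s).1 i :=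
  rfl

/-- The multiplication map `μ : H^0(M(a)) × H^0(𝒪(b)) → H^0(M(a + b))`, as a `k`-bilinear map. -/
def mulH0 (M : (ProjSpace k N).Modules) (a b : ℤ) :
    H0 (serreTwist M a) →ₗ[k] H0 (sheafO k N b) →ₗ[k] H0 (serreTwist M (a + b)) :=
  LinearMap.mk₂ k
    (fun s t ↦ (twistMul (chart k N) (transition_add k N a b) (M := M) (U := ⊤) s t :
      twistSections (chart k N) (transition k N (a + b)) M ⊤))
    (fun s s' t ↦ twist_ext (M := M) (chart k N) (transition k N (a + b)) fun i ↦
      smul_add (unitToFun ((show twistSections (chart k N) (transition k N b) _ ⊤ from t).1 i))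
        ((show twistSections (chart k N) (transition k N a) M ⊤ from s).1 i)
        ((show twistSections (chart k N) (transition k N a) M ⊤ from s').1 i))
    (fun c s t ↦ twist_ext (M := M) (chart k N) (transition k N (a + b)) fun i ↦
      smul_comm (unitToFun ((show twistSections (chart k N) (transition k N b) _ ⊤ from t).1 i))
        (resO inf_le_left (constants k N c) : Γ(ProjSpace k N, ⊤ ⊓ chart k N i))
        ((show twistSections (chart k N) (transition k N a) M ⊤ from s).1 i))
    (fun s t t' ↦ twist_ext (M := M) (chart k N) (transition k N (a + b)) fun i ↦
      add_smul (unitToFun ((show twistSections (chart k N) (transition k N b) _ ⊤ from t).1 i))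
        (unitToFun ((show twistSections (chart k N) (transition k N b) _ ⊤ from t').1 i))
        ((show twistSections (chart k N) (transition k N a) M ⊤ from s).1 i))
    (fun c s t ↦ twist_ext (M := M) (chart k N) (transition k N (a + b)) fun i ↦
      mul_smul (resO inf_le_left (constants k N c) : Γ(ProjSpace k N, ⊤ ⊓ chart k N i))
        (unitToFun ((show twistSections (chart k N) (transition k N b) _ ⊤ from t).1 i))
        ((show twistSections (chart k N) (transition k N a) M ⊤ from s).1 i))

/-- The cohomology group `H^i(ℙ^N, F)` (sheaf cohomology of the underlying sheaf of abelian
groups). -/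
def Hi (F : (ProjSpace k N).Modules) (i : ℕ) : Type u :=
  Sheaf.H ((SheafOfModules.toSheaf (ProjSpace k N).ringCatSheaf).obj F) i

instance (F : (ProjSpace k N).Modules) (i : ℕ) : AddCommGroup (Hi F i) :=
  inferInstanceAs (AddCommGroup
    (Sheaf.H ((SheafOfModules.toSheaf (ProjSpace k N).ringCatSheaf).obj F) i))

/-- An `𝒪`-module on `ℙ^N` is coherent if it is quasi-coherent and of finite type
(recall that `ℙ^N` is noetherian). -/
def IsCoherent (M : (ProjSpace k N).Modules) : Prop :=
  SheafOfModules.IsQuasicoherent M ∧ SheafOfModules.IsFiniteType M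

/-- `M` is Castelnuovo–Mumford regular if `H^i(ℙ^N, M(-i)) = 0` for all `i > 0`. -/
def IsCastelnuovoMumfordRegular (M : (ProjSpace k N).Modules) : Prop :=
  ∀ i : ℕ, 0 < i → ∀ x : Hi (serreTwist M (-(i : ℤ))) i, x = 0

/-- The image `μ(V ⊗ H^0(𝒪(1))) ⊆ H^0(M(n + 1))` for a subspace `V ⊆ H^0(M(n))`, that is, the span of
the products of the elements of `V` with the global sections of `𝒪(1)`. -/
def mulByLinear (M : (ProjSpace k N).Modules) (n : ℤ) (V : Submodule k (H0 (serreTwist M n))) :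
    Submodule k (H0 (serreTwist M (n + 1))) :=
  Submodule.map₂ (mulH0 M n 1) V ⊤

end ProjectiveSpace

end

section Macaulay

/-- `c = C(κ d, d) + C(κ (d - 1), d - 1) + ⋯ + C(κ f, f)` with `κ d > κ (d - 1) > ⋯ > κ f ≥ f ≥ 1`. -/
structure IsMacaulayExpansion (c d f : ℕ) (κ : ℕ → ℕ) : Prop where
  one_le : 1 ≤ f
  le : f ≤ d
  le_apply : f ≤ κ f
  lt_succ : ∀ i, f ≤ i → i < d → κ i < κ (i + 1)
  sum_eq : c = ∑ i ∈ Finset.Icc f d, (κ i).choose i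

theorem exists_macaulayExpansion (d : ℕ) (hd : 1 ≤ d) : ∀ c, 1 ≤ c →
    ∃ f κ, IsMacaulayExpansion c d f κ ∧ ∀ m : ℕ, c < m.choose d → κ d < m := by
  induction d, hd using Nat.le_induction with
  | base =>
    intro c hc
    exact ⟨1, fun _ ↦ c, ⟨le_rfl, le_rfl, hc, by grind, by simp⟩, fun m hm ↦ by simpa using hm⟩
  | succ d hd ih =>
    intro c hc
    have hex : ∃ m : ℕ, c < m.choose (d + 1) := by
      refine ⟨c + (d + 1), ?_⟩
      have h1 : (c + 1).choose 1 ≤ (c + 1 + d).choose (1 + d) := by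
        clear ih hd
        induction d with
        | zero => simp
        | succ d ih =>
          refine ih.trans ?_
          have : c + 1 + (d + 1) = (c + 1 + d) + 1 := by ring
          have h2 : 1 + (d + 1) = (1 + d) + 1 := by ring
          rw [this, h2, Nat.choose_succ_succ']
          omega
      rw [Nat.choose_one_right, show c + 1 + d = c + (d + 1) by ring, Nat.add_comm 1 d] at h1
      omega
    classical
    obtain ⟨K, hK⟩ : ∃ K, Nat.find hex = K + 1 := by
      refine Nat.exists_eq_succ_of_ne_zero fun h0 ↦ ?_
      have := Nat.find_spec hex
      rw [h0] at this
      simp at this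
    have hlt : c < (K + 1).choose (d + 1) := hK ▸ Nat.find_spec hex
    have hge : K.choose (d + 1) ≤ c := not_lt.1 (Nat.find_min hex (m := K) (by omega))
    have hmin : ∀ m : ℕ, c < m.choose (d + 1) → K < m := fun m hm ↦ by
      have := Nat.find_min' hex hm
      omega
    have hKd : d + 1 ≤ K := by
      by_contra hcon
      have h3 : (K + 1).choose (d + 1) ≤ (d + 1).choose (d + 1) := Nat.choose_le_choose _ (by omega)
      rw [Nat.choose_self] at h3
      omega
    rw [Nat.choose_succ_succ'] at hlt
    rcases Nat.eq_zero_or_pos (c - K.choose (d + 1)) with h0 | h0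
    · refine ⟨d + 1, fun _ ↦ K, ⟨by omega, le_rfl, hKd, by grind, ?_⟩, hmin⟩
      simp
      omega
    · obtain ⟨f, κ, ⟨h1, h2, h3, h4, h5⟩, h6⟩ := ih _ h0
      have h7 := h6 K (by omega)
      refine ⟨f, fun i ↦ if i = d + 1 then K else κ i, ⟨h1, by omega, ?_, ?_, ?_⟩, ?_⟩
      · grind
      · intro i hi hi'
        rcases Nat.lt_succ_iff_lt_or_eq.1 hi' with h | rfl
        · have := h4 i hi h
          grind
        · grind
      · rw [Finset.sum_Icc_succ_top (by omega)]
        have : ∑ i ∈ Finset.Icc f d, (if i = d + 1 then K else κ i).choose i =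
            ∑ i ∈ Finset.Icc f d, (κ i).choose i :=
          Finset.sum_congr rfl fun i hi ↦ by
            rw [if_neg (by have := Finset.mem_Icc.1 hi; omega)]
        rw [this, ← h5]
        simp
        omega
      · simpa using hmin

theorem IsMacaulayExpansion.le_apply' {c d f : ℕ} {κ : ℕ → ℕ} (h : IsMacaulayExpansion c d f κ) :
    ∀ i, f ≤ i → i ≤ d → i ≤ κ i := by
  intro i hi
  induction i, hi using Nat.le_induction with
  | base => exact fun _ ↦ h.le_apply
  | succ i hi ih => exact fun hid ↦ by have := h.lt_succ i hi (by omega); have := ih (by omega); omega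

theorem IsMacaulayExpansion.tail {c d f : ℕ} {κ : ℕ → ℕ} (h : IsMacaulayExpansion c (d + 1) f κ) :
    (f = d + 1 ∧ c = (κ (d + 1)).choose (d + 1)) ∨
    ∃ r, IsMacaulayExpansion r d f κ ∧ c = r + (κ (d + 1)).choose (d + 1) ∧ κ d < κ (d + 1) := by
  obtain ⟨h1, h2, h3, h4, h5⟩ := h
  rcases Nat.lt_or_ge d f with hf | hf
  · left
    obtain rfl : f = d + 1 := by omega
    exact ⟨rfl, by simpa using h5⟩
  · right
    refine ⟨_, ⟨h1, hf, h3, fun i hi hi' ↦ h4 i hi (by omega), rfl⟩, ?_, h4 d hf (by omega)⟩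
    rw [h5, Finset.sum_Icc_succ_top (by omega)]

theorem IsMacaulayExpansion.pos {c d f : ℕ} {κ : ℕ → ℕ} (h : IsMacaulayExpansion c d f κ) :
    0 < c := by
  rw [h.sum_eq]
  exact Finset.sum_pos' (fun _ _ ↦ Nat.zero_le _)
    ⟨f, Finset.mem_Icc.2 ⟨le_rfl, h.le⟩, Nat.choose_pos h.le_apply⟩

theorem IsMacaulayExpansion.bounds {c d f : ℕ} {κ : ℕ → ℕ} (h : IsMacaulayExpansion c d f κ) :
    (κ d).choose d ≤ c ∧ c < (κ d + 1).choose d := by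
  induction d generalizing c with
  | zero => have := h.one_le; have := h.le; omega
  | succ d ih =>
    have hd := h.le_apply' (d + 1) h.le le_rfl
    rw [Nat.choose_succ_succ']
    rcases h.tail with ⟨_, rfl⟩ | ⟨r, hr, rfl, hlt⟩
    · have : 0 < (κ (d + 1)).choose d := Nat.choose_pos (by omega)
      omega
    · have := ih hr
      have h2 : (κ d + 1).choose d ≤ (κ (d + 1)).choose d := Nat.choose_le_choose _ hlt
      omega

theorem IsMacaulayExpansion.unique {c d f f' : ℕ} {κ κ' : ℕ → ℕ} (h : IsMacaulayExpansion c d f κ)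
    (h' : IsMacaulayExpansion c d f' κ') : f = f' ∧ ∀ i, f ≤ i → i ≤ d → κ i = κ' i := by
  induction d generalizing c with
  | zero => have := h.one_le; have := h.le; omega
  | succ d ih =>
    have hb := h.bounds
    have hb' := h'.bounds
    have htop : κ (d + 1) = κ' (d + 1) := by
      rcases lt_trichotomy (κ (d + 1)) (κ' (d + 1)) with hl | he | hl
      · have := Nat.choose_le_choose (d + 1) (show κ (d + 1) + 1 ≤ _ from hl)
        omega
      · exact he
      · have := Nat.choose_le_choose (d + 1) (show κ' (d + 1) + 1 ≤ _ from hl)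
        omega
    rcases h.tail with ⟨hf, hc⟩ | ⟨r, hr, hc, -⟩ <;>
      rcases h'.tail with ⟨hf', hc'⟩ | ⟨r', hr', hc', -⟩
    · refine ⟨by omega, fun i hi hi' ↦ ?_⟩
      obtain rfl : i = d + 1 := by omega
      exact htop
    · have := hr'.pos
      rw [htop] at hc
      omega
    · have := hr.pos
      rw [htop] at hc
      omega
    · obtain rfl : r = r' := by rw [htop] at hc; omega
      obtain ⟨h1, h2⟩ := ih hr hr'
      refine ⟨h1, fun i hi hi' ↦ ?_⟩
      rcases Nat.lt_succ_iff_lt_or_eq.1 (Nat.lt_succ_of_le hi') with hlt | rfl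
      · exact h2 i hi (by omega)
      · exact htop

open Classical in
/-- The number `c^{<d>}`: if `c = ∑ C(κ i, i)`, `f ≤ i ≤ d`, is the (unique) Macaulay expansion of
`c ≥ 1`, `d ≥ 1`, then `c^{<d>} = ∑ C(κ i + 1, i + 1)`; and `0^{<d>} = 0`. -/
noncomputable def macaulayBound (c d : ℕ) : ℕ :=
  if h : ∃ p : ℕ × (ℕ → ℕ), IsMacaulayExpansion c d p.1 p.2 then
    ∑ i ∈ Finset.Icc h.choose.1 d, (h.choose.2 i + 1).choose (i + 1)
  else 0

theorem macaulayBound_eq {c d f : ℕ} {κ : ℕ → ℕ} (h : IsMacaulayExpansion c d f κ) :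
    macaulayBound c d = ∑ i ∈ Finset.Icc f d, (κ i + 1).choose (i + 1) := by
  have hex : ∃ p : ℕ × (ℕ → ℕ), IsMacaulayExpansion c d p.1 p.2 := ⟨(f, κ), h⟩
  rw [macaulayBound, dif_pos hex]
  obtain ⟨h1, h2⟩ := h.unique hex.choose_spec
  rw [← h1]
  refine Finset.sum_congr rfl fun i hi ↦ ?_
  rw [Finset.mem_Icc] at hi
  rw [h2 i hi.1 hi.2]

theorem macaulayBound_zero (d : ℕ) : macaulayBound 0 d = 0 :=
  dif_neg fun ⟨_, h⟩ ↦ h.pos.ne' rfl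

end Macaulay

end CMReg

/-! Two facts are joined. Mumford's lemma: for regular M, the module ⨁_{n ≥ 0} H^0(M(n)) over k[x_0,
…, x_N] is generated in degree 0 (`iSup_range_mulCoordH0`). Macaulay's growth bound: it holds for
every graded module F generated in degree 0 (`rank_quotient_le_macaulayBound`). The products of V
with the coordinates lie in V^{d+1}, so it suffices to bound the codimension of their span.

Macaulay's bound reduces to counting. Well-order F_0 and order the products e · x^a
lexicographically. Those of degree d outside the span of the smaller ones modulo V are independent
in F_d / V, so there are at most c of them; those of degree d + 1, taken modulo ∑ x_j V, span the
quotient; and cancelling a variable in one of the latter gives one of the former. Giving each e its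
own copy of the variables turns pairs (e, a) into monomials. It remains to see that a set A of
monomials of degree d + 1 whose shadow ∂A has at most c elements has at most c^{<d>} elements
(`card_le_macaulayBound`).

Compression makes A shifted without enlarging the shadow (`exists_isShifted`). If A is shifted and
x_v is the first variable, then |A| = |∂A| + |A_0|, where A_0 consists of the elements free of x_v
(`IsShifted.card_eq`). A double induction, on degree and on size, deduces |A_0| ≤ ∑ C(κ_i, i + 1)
from |∂A| ≤ ∑ C(κ_i, i) (`IsShifted.card_filter_le`); Pascal's rule adds the two bounds.

For Mumford's lemma, the Koszul complex of the coordinates is exact on sheaves, since near each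
point some x_i is invertible. Dimension shifting along it (`exists_comp_koszulD_zero_eq`) carries
the vanishing of H^i(M(n - i)) to H^i(M(n + 1 - i)), and in degree 0 makes H^0(M(n))^{N+1} → H^0(M(n
+ 1)) surjective. -/

namespace CMReg

/-! ### Macaulay's theorem for sets of monomials: shifting and compression. -/

section Shadow

open Finset Finsupp

/-- The shadow of a set of monomials: all monomials `b` such that `b + eₗ` is in the set. -/
noncomputable def shadow (A : Finset (ℕ →₀ ℕ)) : Finset (ℕ →₀ ℕ) :=
  A.biUnion fun a ↦ a.support.image fun l ↦ a - single l 1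

theorem mem_shadow {A : Finset (ℕ →₀ ℕ)} {b : ℕ →₀ ℕ} :
    b ∈ shadow A ↔ ∃ l, b + single l 1 ∈ A := by
  simp only [shadow, mem_biUnion, mem_image, Finsupp.mem_support_iff]
  constructor
  · rintro ⟨a, ha, l, hl, rfl⟩
    refine ⟨l, ?_⟩
    rwa [tsub_add_cancel_of_le]
    rw [Finsupp.single_le_iff]
    omega
  · rintro ⟨l, hl⟩
    exact ⟨_, hl, l, by simp, by simp⟩

/-- A set of monomials in the variables of index at least `v` which is closed under replacing a
variable by one of smaller index, at least `v`. -/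
structure IsShifted (v : ℕ) (A : Finset (ℕ →₀ ℕ)) : Prop where
  eq_zero : ∀ a ∈ A, ∀ l < v, a l = 0
  shift : ∀ b i j, v ≤ i → i < j → b + single j 1 ∈ A → b + single i 1 ∈ A

theorem IsShifted.shadow {v : ℕ} {A : Finset (ℕ →₀ ℕ)} (h : IsShifted v A) :
    IsShifted v (shadow A) where
  eq_zero b hb l hl := by
    obtain ⟨i, hi⟩ := mem_shadow.1 hb
    have := h.eq_zero _ hi l hl
    rw [Finsupp.add_apply] at this
    omega
  shift b i j hi hij hb := by
    obtain ⟨l, hl⟩ := mem_shadow.1 hb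
    refine mem_shadow.2 ⟨l, ?_⟩
    rw [add_right_comm] at hl ⊢
    exact h.shift _ _ _ hi hij hl

theorem IsShifted.filter {v : ℕ} {A : Finset (ℕ →₀ ℕ)} (h : IsShifted v A) :
    IsShifted (v + 1) {a ∈ A | a v = 0} where
  eq_zero a ha l hl := by
    rw [mem_filter] at ha
    rcases Nat.lt_succ_iff_lt_or_eq.1 hl with hl | rfl
    · exact h.eq_zero a ha.1 l hl
    · exact ha.2
  shift b i j hi hij hb := by
    rw [mem_filter] at hb ⊢
    refine ⟨h.shift b i j (by omega) hij hb.1, ?_⟩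
    have := hb.2
    simp only [Finsupp.add_apply, Finsupp.single_apply] at this ⊢
    rw [if_neg (by omega)]
    omega

theorem shadow_filter_subset (v : ℕ) (A : Finset (ℕ →₀ ℕ)) :
    shadow {a ∈ A | a v = 0} ⊆ {b ∈ shadow A | b v = 0} := by
  intro b hb
  obtain ⟨l, hl⟩ := mem_shadow.1 hb
  rw [mem_filter] at hl
  refine mem_filter.2 ⟨mem_shadow.2 ⟨l, hl.1⟩, ?_⟩
  have := hl.2
  rw [Finsupp.add_apply] at this
  omega

/-- Multiplication by x_v is a bijection from the shadow onto the elements of `A` divisible by x_v: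
if b x_l lies in `A`, then l ≥ v, and shiftedness puts b x_v in `A`. -/
theorem IsShifted.card_eq {v : ℕ} {A : Finset (ℕ →₀ ℕ)} (h : IsShifted v A) :
    #A = #(CMReg.shadow A) + #{a ∈ A | a v = 0} := by
  have h1 : {a ∈ A | ¬ a v = 0} = (CMReg.shadow A).map (addRightEmbedding (single v 1)) := by
    ext a
    simp only [mem_filter, mem_map, addRightEmbedding_apply]
    constructor
    · rintro ⟨ha, hv⟩
      have : a - single v 1 + single v 1 = a := by
        rw [tsub_add_cancel_of_le]
        rw [Finsupp.single_le_iff]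
        omega
      refine ⟨_, mem_shadow.2 ⟨v, ?_⟩, this⟩
      rwa [this]
    · rintro ⟨b, hb, rfl⟩
      refine ⟨?_, by simp⟩
      obtain ⟨l, hl⟩ := mem_shadow.1 hb
      rcases lt_trichotomy l v with hlt | rfl | hlt
      · have := h.eq_zero _ hl l hlt
        simp at this
      · exact hl
      · exact h.shift b v l le_rfl hlt hl
  rw [← card_filter_add_card_filter_not (s := A) (fun a ↦ a v = 0), h1, card_map, add_comm]

theorem shadow_nonempty {A : Finset (ℕ →₀ ℕ)} {n : ℕ} (h : ∀ a ∈ A, a.degree = n + 1)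
    (hA : A.Nonempty) : (shadow A).Nonempty := by
  obtain ⟨a, ha⟩ := hA
  have h0 : a ≠ 0 := by
    rintro rfl
    simpa using h 0 ha
  obtain ⟨l, hl⟩ := Finsupp.support_nonempty_iff.2 h0
  refine ⟨a - single l 1, mem_shadow.2 ⟨l, ?_⟩⟩
  rwa [tsub_add_cancel_of_le]
  rw [Finsupp.single_le_iff]
  have := Finsupp.mem_support_iff.1 hl
  omega

theorem degree_of_mem_shadow {A : Finset (ℕ →₀ ℕ)} {n : ℕ} (h : ∀ a ∈ A, a.degree = n + 1)
    {b : ℕ →₀ ℕ} (hb : b ∈ shadow A) : b.degree = n := by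
  obtain ⟨l, hl⟩ := mem_shadow.1 hb
  simpa using h _ hl

/-- If the number of elements of the shadow is at most `∑ C(κ i, i)`, then at most `∑ C(κ i, i + 1)`
elements of a shifted set do not involve the first variable. -/
theorem IsShifted.card_filter_le (d : ℕ) : ∀ (n v : ℕ) (A : Finset (ℕ →₀ ℕ)) (κ : ℕ → ℕ), #A ≤ n →
    IsShifted v A → (∀ a ∈ A, a.degree = d + 2) →
    #(CMReg.shadow A) ≤ ∑ i ∈ range (d + 1), (κ i).choose (i + 1) →
    #{a ∈ A | a v = 0} ≤ ∑ i ∈ range (d + 1), (κ i).choose (i + 2) := by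
  induction d with
  | zero =>
    -- Here the shadow B consists of variables. If B is nonempty, so is its own shadow, and
    -- `card_eq` for B gains the 1.
    have key : ∀ (v : ℕ) (A : Finset (ℕ →₀ ℕ)) (κ : ℕ → ℕ), IsShifted v A →
        (∀ a ∈ A, a.degree = 2) → #(CMReg.shadow A) ≤ κ 0 →
        #{b ∈ CMReg.shadow A | b v = 0} ≤ κ 0 - 1 := by
      intro v A κ hA hdeg hle
      rcases (CMReg.shadow A).eq_empty_or_nonempty with h0 | h0
      · simp [h0]
      · have h1 := hA.shadow.card_eq
        have h2 := card_pos.2 (shadow_nonempty (n := 0)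
          (fun b hb ↦ degree_of_mem_shadow (n := 1) hdeg hb) h0)
        omega
    intro n
    induction n with
    | zero =>
      intro v A κ hn _ _ _
      have : A = ∅ := by simpa using hn
      simp [this]
    | succ n ih =>
      intro v A κ hn hA hdeg hle
      rcases A.eq_empty_or_nonempty with h0 | h0
      · simp [h0]
      have h1 := hA.card_eq
      have h2 := card_pos.2 (shadow_nonempty (n := 1) hdeg h0)
      have h3 := key v A κ hA hdeg (by simpa using hle)
      have h4 := (card_le_card (shadow_filter_subset v A)).trans h3
      have h5 := ih (v + 1) {a ∈ A | a v = 0} (fun i ↦ κ i - 1) (by omega) hA.filter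
        (fun a ha ↦ hdeg a (mem_filter.1 ha).1) (by simpa using h4)
      rw [hA.filter.card_eq]
      simp only [zero_add, range_one, sum_singleton] at h5 ⊢
      refine (add_le_add h4 h5).trans ?_
      rcases hk : κ 0 with _ | m
      · simp
      · simp [Nat.choose_succ_succ' m 1]
  | succ d ihd =>
    -- Let B = ∂A. If ∂B is small, induction on the degree bounds B_0 by the terms of positive index
    -- alone. If not, |B_0| = |B| - |∂B| with |∂B| exceeding its threshold by at least 1; that 1
    -- turns κ 0 into κ 0 - 1. No monotonicity of κ is needed, so passing to κ - 1 is harmless.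
    have key : ∀ (v : ℕ) (A : Finset (ℕ →₀ ℕ)) (κ : ℕ → ℕ), IsShifted v A →
        (∀ a ∈ A, a.degree = d + 1 + 2) →
        #(CMReg.shadow A) ≤ ∑ i ∈ range (d + 1 + 1), (κ i).choose (i + 1) →
        #{b ∈ CMReg.shadow A | b v = 0} ≤ ∑ i ∈ range (d + 1 + 1), (κ i - 1).choose (i + 1) := by
      intro v A κ hA hdeg hle
      rw [sum_range_succ'] at hle ⊢
      simp only [zero_add, Nat.choose_one_right] at hle ⊢
      by_cases hc : #(CMReg.shadow (CMReg.shadow A)) ≤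
          ∑ i ∈ range (d + 1), (κ (i + 1) - 1).choose (i + 1)
      · exact (ihd _ v _ (fun i ↦ κ (i + 1) - 1) le_rfl hA.shadow
          (fun b hb ↦ degree_of_mem_shadow (n := d + 2) hdeg hb) hc).trans (Nat.le_add_right _ _)
      · have h1 := hA.shadow.card_eq
        have h2 : ∑ i ∈ range (d + 1), (κ (i + 1)).choose (i + 1 + 1) ≤
            ∑ i ∈ range (d + 1), (κ (i + 1) - 1).choose (i + 1) +
            ∑ i ∈ range (d + 1), (κ (i + 1) - 1).choose (i + 1 + 1) := by
          rw [← sum_add_distrib]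
          refine sum_le_sum fun i _ ↦ ?_
          rcases κ (i + 1) with _ | m
          · simp
          · rw [Nat.choose_succ_succ', Nat.add_sub_cancel]
        omega
    intro n
    induction n with
    | zero =>
      intro v A κ hn _ _ _
      have : A = ∅ := by simpa using hn
      simp [this]
    | succ n ih =>
      intro v A κ hn hA hdeg hle
      rcases A.eq_empty_or_nonempty with h0 | h0
      · simp [h0]
      have h1 := hA.card_eq
      have h2 := card_pos.2 (shadow_nonempty (n := d + 2) hdeg h0)
      have h4 := (card_le_card (shadow_filter_subset v A)).trans (key v A κ hA hdeg hle)
      -- A_0 is smaller than A because ∂A is nonempty, and ∂(A_0) ⊆ (∂A)_0 satisfies the bound for κ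
      -- - 1.
      have h5 := ih (v + 1) {a ∈ A | a v = 0} (fun i ↦ κ i - 1) (by omega) hA.filter
        (fun a ha ↦ hdeg a (mem_filter.1 ha).1) h4
      rw [hA.filter.card_eq]
      refine (add_le_add h4 h5).trans ?_
      rw [← sum_add_distrib]
      refine sum_le_sum fun i _ ↦ ?_
      rcases κ i with _ | m
      · simp
      · rw [Nat.choose_succ_succ', Nat.add_sub_cancel]

theorem IsShifted.card_le {d v : ℕ} {A : Finset (ℕ →₀ ℕ)} (hA : IsShifted v A) {κ : ℕ → ℕ}
    (hdeg : ∀ a ∈ A, a.degree = d + 2)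
    (hle : #(CMReg.shadow A) ≤ ∑ i ∈ range (d + 1), (κ i).choose (i + 1)) :
    #A ≤ ∑ i ∈ range (d + 1), (κ i + 1).choose (i + 2) := by
  rw [hA.card_eq]
  refine (add_le_add hle (hA.card_filter_le d _ v A κ le_rfl hdeg hle)).trans ?_
  rw [← sum_add_distrib]
  exact sum_le_sum fun i _ ↦ by rw [Nat.choose_succ_succ' _ (i + 1)]

/-! ### Compression -/

variable (i j : ℕ)

/-- The monomial of the same degree as `y` with exponent `t` at `j`, which differs from `y` only at `i` and
`j`. -/
noncomputable def lineAt (y : ℕ →₀ ℕ) (t : ℕ) : ℕ →₀ ℕ :=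
  (y.update j t).update i (y i + y j - t)

/-- The exponents of `j` in the elements of `A` which differ from `y` only at `i` and `j`. -/
noncomputable def lineFiber (A : Finset (ℕ →₀ ℕ)) (y : ℕ →₀ ℕ) : Finset ℕ :=
  {t ∈ range (y i + y j + 1) | lineAt i j y t ∈ A}

/-- Replace the exponent of `j` in `y` by its position among the elements of `A` which differ from `y` only
at `i` and `j`. -/
noncomputable def push (A : Finset (ℕ →₀ ℕ)) (y : ℕ →₀ ℕ) : ℕ →₀ ℕ :=
  lineAt i j y #{t ∈ lineFiber i j A y | t < y j}

/-- The compression of a set of monomials in direction `j → i`. -/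
noncomputable def compress (A : Finset (ℕ →₀ ℕ)) : Finset (ℕ →₀ ℕ) := A.image (push i j A)

variable {i j}

theorem lineAt_apply (y : ℕ →₀ ℕ) (t l : ℕ) : lineAt i j y t l =
    if l = i then y i + y j - t else if l = j then t else y l := by
  simp only [lineAt, Finsupp.update_apply]

theorem lineAt_lineAt (hij : i ≠ j) (y : ℕ →₀ ℕ) {t : ℕ} (ht : t ≤ y i + y j) (t' : ℕ) :
    lineAt i j (lineAt i j y t) t' = lineAt i j y t' := by
  ext l
  simp only [lineAt_apply]
  grind

theorem lineAt_self (y : ℕ →₀ ℕ) : lineAt i j y (y j) = y := by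
  ext l
  simp only [lineAt_apply]
  grind

theorem lineFiber_lineAt (hij : i ≠ j) (A : Finset (ℕ →₀ ℕ)) (y : ℕ →₀ ℕ) {t : ℕ}
    (ht : t ≤ y i + y j) : lineFiber i j A (lineAt i j y t) = lineFiber i j A y := by
  ext t'
  simp only [lineFiber, mem_filter, lineAt_lineAt hij y ht]
  simp only [lineAt_apply, mem_range]
  grind

theorem mem_lineFiber_self {A : Finset (ℕ →₀ ℕ)} {y : ℕ →₀ ℕ} (hy : y ∈ A) :
    y j ∈ lineFiber i j A y := by
  rw [lineFiber, mem_filter, lineAt_self, mem_range]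
  exact ⟨by omega, hy⟩

theorem position_le (T : Finset ℕ) (m : ℕ) : #{t ∈ T | t < m} ≤ m := by
  calc #{t ∈ T | t < m} ≤ #(range m) := card_le_card fun t ht ↦ mem_range.2 (mem_filter.1 ht).2
    _ = m := card_range m

theorem position_lt_card {T : Finset ℕ} {m : ℕ} (hm : m ∈ T) : #{t ∈ T | t < m} < #T :=
  card_lt_card <| (filter_ssubset).2 ⟨m, hm, lt_irrefl m⟩

theorem position_strictMonoOn {T : Finset ℕ} {m m' : ℕ} (hm : m ∈ T) (h : m < m') :
    #{t ∈ T | t < m} < #{t ∈ T | t < m'} := by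
  refine card_lt_card ⟨fun t ht ↦ ?_, fun hsub ↦ ?_⟩
  · rw [mem_filter] at ht ⊢
    exact ⟨ht.1, ht.2.trans h⟩
  · have := hsub (mem_filter.2 ⟨hm, h⟩)
    simp at this

theorem exists_position_eq (T : Finset ℕ) {n : ℕ} (hn : n < #T) :
    ∃ m ∈ T, #{t ∈ T | t < m} = n := by
  induction T using Finset.induction_on_max with
  | empty => simp at hn
  | insert a s ha ih =>
    have has : a ∉ s := fun h ↦ lt_irrefl a (ha a h)
    rw [card_insert_of_notMem has] at hn
    rcases Nat.lt_succ_iff_lt_or_eq.1 hn with h | rfl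
    · obtain ⟨m, hm, hc⟩ := ih h
      refine ⟨m, mem_insert_of_mem hm, ?_⟩
      rw [filter_insert, if_neg (not_lt.2 (ha m hm).le), hc]
    · refine ⟨a, mem_insert_self _ _, ?_⟩
      rw [filter_insert, if_neg (lt_irrefl a), filter_true_of_mem ha]

/-- Positions in a finite set of size r run through 0, …, r - 1, so on each line compression yields
an initial segment of exponents of j. -/
theorem mem_compress (hij : i ≠ j) {A : Finset (ℕ →₀ ℕ)} {y : ℕ →₀ ℕ} :
    y ∈ compress i j A ↔ y j < #(lineFiber i j A y) := by
  rw [compress, mem_image]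
  constructor
  · rintro ⟨b, hb, rfl⟩
    have hle := position_le (lineFiber i j A b) (b j)
    rw [push, lineFiber_lineAt hij _ _ (by omega), lineAt_apply, if_neg hij.symm, if_pos rfl]
    exact position_lt_card (mem_lineFiber_self hb)
  · intro h
    obtain ⟨m, hm, hc⟩ := exists_position_eq _ h
    have hm' := (mem_filter.1 hm)
    rw [mem_range] at hm'
    refine ⟨lineAt i j y m, hm'.2, ?_⟩
    rw [push, lineFiber_lineAt hij _ _ (by omega), lineAt_lineAt hij _ (by omega),
      lineAt_apply _ m, if_neg hij.symm, if_pos rfl, hc, lineAt_self]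

/-- A monomial stays on its line, and its position determines it among the elements of `A` there. -/
theorem push_injOn (hij : i ≠ j) (A : Finset (ℕ →₀ ℕ)) : Set.InjOn (push i j A) A := by
  intro a ha b hb hab
  have hla := position_le (lineFiber i j A a) (a j)
  have hlb := position_le (lineFiber i j A b) (b j)
  have hT : lineFiber i j A a = lineFiber i j A b := by
    rw [← lineFiber_lineAt hij A a (t := #{t ∈ lineFiber i j A a | t < a j}) (by omega),
      ← lineFiber_lineAt hij A b (t := #{t ∈ lineFiber i j A b | t < b j}) (by omega)]
    exact congrArg _ hab
  have hj := DFunLike.congr_fun hab j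
  simp only [push, lineAt_apply, if_neg hij.symm, if_true] at hj
  have hma := mem_lineFiber_self (i := i) (j := j) ha
  have hmb := mem_lineFiber_self (i := i) (j := j) hb
  have hjj : a j = b j := by
    rw [hT] at hj hma
    rcases lt_trichotomy (a j) (b j) with h | h | h
    · exact absurd hj (position_strictMonoOn hma h).ne
    · exact h
    · exact absurd hj (position_strictMonoOn hmb h).ne'
  calc a = lineAt i j (push i j A a) (a j) := by
        rw [push, lineAt_lineAt hij _ (by omega), lineAt_self]
    _ = lineAt i j (push i j A b) (b j) := by rw [hab, hjj]
    _ = b := by rw [push, lineAt_lineAt hij _ (by omega), lineAt_self]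

theorem card_compress (hij : i ≠ j) (A : Finset (ℕ →₀ ℕ)) : #(compress i j A) = #A :=
  card_image_of_injOn (push_injOn hij A)

theorem card_le_card_add_one_of_pred_mem {T T' : Finset ℕ} (h : ∀ t, t + 1 ∈ T → t ∈ T') :
    #T ≤ #T' + 1 := by
  have : T ⊆ insert 0 (T'.image (· + 1)) := by
    intro t ht
    rcases t with _ | t
    · simp
    · simpa using h t ht
  refine (card_le_card this).trans ((card_insert_le _ _).trans ?_)
  exact Nat.add_le_add_right card_image_le 1

/-- Serves the case of division by x_i below: `T` lies on a line of total exponent s + 1, `T'` on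
one of total exponent s, and the two hypotheses are division by x_j and by x_i. If `T` misses u ≤ s
+ 1, closing the gap at u injects `T` into `T'`; otherwise `T'` contains all of 0, …, s. -/
theorem lt_card_of_pred_mem {T T' : Finset ℕ} {s r : ℕ} (h : ∀ t, t + 1 ∈ T → t ∈ T')
    (h' : ∀ t ∈ T, t ≤ s → t ∈ T') (hr : r ≤ s) (hT : r < #T) : r < #T' := by
  by_cases hfull : ∃ u ≤ s + 1, u ∉ T
  · obtain ⟨u, hu, huT⟩ := hfull
    refine hT.trans_le (card_le_card_of_injOn (fun t ↦ if t < u then t else t - 1) ?_ ?_)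
    · intro t ht
      simp only [SetLike.mem_coe] at ht ⊢
      split_ifs with htu
      · exact h' t ht (by omega)
      · refine h _ ?_
        have : t ≠ u := fun h ↦ huT (h ▸ ht)
        rwa [show t - 1 + 1 = t by omega]
    · intro t ht t' ht' htt'
      simp only [SetLike.mem_coe] at ht ht'
      have h1 : t ≠ u := fun h ↦ huT (h ▸ ht)
      have h2 : t' ≠ u := fun h ↦ huT (h ▸ ht')
      simp only at htt'
      split_ifs at htt' <;> omega
  · push Not at hfull
    have : range (s + 1) ⊆ T' := fun t ht ↦ h t (hfull _ (by simpa using ht))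
    have := card_le_card this
    rw [card_range] at this
    omega

/-- By `mem_compress` this compares the sizes of two fibres, that of `A` on the line of y x_l and
that of ∂A on the line of y. The cases are l = i, l = j (a loss of one is allowed, as y_j also drops
by one) and l different from both (the fibre is simply contained). -/
theorem shadow_compress_subset (hij : i ≠ j) (A : Finset (ℕ →₀ ℕ)) :
    shadow (compress i j A) ⊆ compress i j (shadow A) := by
  intro y hy
  obtain ⟨l, hl⟩ := mem_shadow.1 hy
  rw [mem_compress hij] at hl ⊢
  have key : ∀ m t t', t' ≤ y i + y j → lineAt i j y t' + single m 1 = lineAt i j (y + single l 1) t →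
      t ∈ lineFiber i j A (y + single l 1) → t' ∈ lineFiber i j (shadow A) y := by
    intro m t t' ht' heq ht
    rw [lineFiber, mem_filter] at ht ⊢
    exact ⟨by simpa [Nat.lt_succ_iff] using ht', mem_shadow.2 ⟨m, heq ▸ ht.2⟩⟩
  have hrange : ∀ t ∈ lineFiber i j A (y + single l 1),
      t ≤ (y + single l 1 : ℕ →₀ ℕ) i + (y + single l 1 : ℕ →₀ ℕ) j := by
    intro t ht
    have := (mem_filter.1 ht).1
    rw [mem_range] at this
    omega
  by_cases hli : l = i
  · subst hli
    have h1 : (y + single l 1 : ℕ →₀ ℕ) j = y j := by simp [hij]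
    have h2 : (y + single l 1 : ℕ →₀ ℕ) l = y l + 1 := by simp
    rw [h1] at hl
    refine lt_card_of_pred_mem (s := y l + y j) (fun t ht ↦ ?_) (fun t ht hts ↦ ?_) (by omega) hl
    · have := hrange _ ht
      refine key j _ t (by omega) ?_ ht
      ext m
      simp only [Finsupp.add_apply, lineAt_apply, Finsupp.single_apply]
      grind
    · refine key l _ t hts ?_ ht
      ext m
      simp only [Finsupp.add_apply, lineAt_apply, Finsupp.single_apply]
      grind
  · by_cases hlj : l = j
    · subst hlj
      have h1 : (y + single l 1 : ℕ →₀ ℕ) i = y i := by simp [hij]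
      have h2 : (y + single l 1 : ℕ →₀ ℕ) l = y l + 1 := by simp
      rw [h2] at hl
      have := card_le_card_add_one_of_pred_mem (T := lineFiber i l A (y + single l 1))
        (T' := lineFiber i l (shadow A) y) fun t ht ↦ by
          have := hrange _ ht
          refine key l _ t (by omega) ?_ ht
          ext m
          simp only [Finsupp.add_apply, lineAt_apply, Finsupp.single_apply]
          grind
      omega
    · have h1 : (y + single l 1 : ℕ →₀ ℕ) j = y j := by simp [hlj]
      have h2 : (y + single l 1 : ℕ →₀ ℕ) i = y i := by simp [hli]
      rw [h1] at hl
      refine hl.trans_le (card_le_card fun t ht ↦ ?_)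
      have := hrange _ ht
      refine key l t t (by omega) ?_ ht
      ext m
      simp only [Finsupp.add_apply, lineAt_apply, Finsupp.single_apply]
      grind

/-- Written without subtracting monomials, so that any additive function, such as degree or weight,
can be applied to both sides. -/
theorem lineAt_add_single (hij : i ≠ j) (y : ℕ →₀ ℕ) {t : ℕ} (ht : t ≤ y j) :
    lineAt i j y t + single j (y j - t) = y + single i (y j - t) := by
  ext m
  simp only [Finsupp.add_apply, lineAt_apply, Finsupp.single_apply]
  grind

theorem degree_of_mem_compress (hij : i ≠ j) {A : Finset (ℕ →₀ ℕ)} {n : ℕ}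
    (h : ∀ a ∈ A, a.degree = n) : ∀ a ∈ compress i j A, a.degree = n := by
  intro a ha
  obtain ⟨b, hb, rfl⟩ := mem_image.1 ha
  have := congrArg Finsupp.degree
    (lineAt_add_single hij b (position_le (lineFiber i j A b) (b j)))
  simp only [map_add, Finsupp.degree_single, h b hb] at this
  rw [push]
  omega

theorem weight_push_add (hij : i ≠ j) (A : Finset (ℕ →₀ ℕ)) (b : ℕ →₀ ℕ) :
    Finsupp.weight (fun t : ℕ ↦ t) (push i j A b) + (b j - #{t ∈ lineFiber i j A b | t < b j}) * j =
      Finsupp.weight (fun t : ℕ ↦ t) b + (b j - #{t ∈ lineFiber i j A b | t < b j}) * i := by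
  have := congrArg (Finsupp.weight (fun t : ℕ ↦ t))
    (lineAt_add_single hij b (position_le (lineFiber i j A b) (b j)))
  rw [push]
  simpa only [map_add, Finsupp.weight_single, smul_eq_mul] using this

/-- Every set of monomials of degree `n` may be replaced by a shifted one, without increasing the
shadow. -/
theorem exists_isShifted (n : ℕ) : ∀ (w : ℕ) (A : Finset (ℕ →₀ ℕ)), (∀ a ∈ A, a.degree = n) →
    ∑ a ∈ A, Finsupp.weight (fun t : ℕ ↦ t) a = w →
    ∃ A' : Finset (ℕ →₀ ℕ), IsShifted 0 A' ∧ (∀ a ∈ A', a.degree = n) ∧ #A' = #A ∧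
      #(shadow A') ≤ #(shadow A) := by
  intro w
  induction w using Nat.strong_induction_on with
  | _ w ih =>
    intro A hA hw
    by_cases hs : ∀ b i j, i < j → b + single j 1 ∈ A → b + single i 1 ∈ A
    · exact ⟨A, ⟨fun _ _ _ h ↦ absurd h (Nat.not_lt_zero _), fun b i j _ ↦ hs b i j⟩, hA, rfl,
        le_rfl⟩
    push Not at hs
    obtain ⟨b, i, j, hij, hj, hi⟩ := hs
    have hne := hij.ne
    -- Compression moves exponents from j to the smaller index i, so no weight grows. The weight of
    -- b x_j drops strictly: exponent b_j is absent from its fibre, since the monomial there is b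
    -- x_i.
    have hlt : ∑ a ∈ compress i j A, Finsupp.weight (fun t : ℕ ↦ t) a < w := by
      rw [compress, sum_image (push_injOn hne A), ← hw]
      refine sum_lt_sum (fun a _ ↦ ?_) ⟨_, hj, ?_⟩
      · have := weight_push_add hne A a
        have := Nat.mul_le_mul_left (a j - #{t ∈ lineFiber i j A a | t < a j}) hij.le
        omega
      · have h1 := weight_push_add hne A (b + single j 1)
        have h2 : #{t ∈ lineFiber i j A (b + single j 1) | t < (b + single j 1 : ℕ →₀ ℕ) j} <
            (b + single j 1 : ℕ →₀ ℕ) j := by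
          have hbj : (b + single j 1 : ℕ →₀ ℕ) j = b j + 1 := by simp
          rw [hbj, Nat.lt_succ_iff]
          refine le_trans (card_le_card (t := range (b j)) fun t ht ↦ ?_) (card_range _).le
          rw [mem_filter, lineFiber, mem_filter] at ht
          have : t ≠ b j := by
            rintro rfl
            refine hi ?_
            convert ht.1.2 using 1
            ext m
            simp only [Finsupp.add_apply, lineAt_apply, Finsupp.single_apply]
            grind
          rw [mem_range]
          omega
        have := Nat.mul_lt_mul_of_pos_left hij (Nat.sub_pos_of_lt h2)
        omega
    obtain ⟨A', h1, h2, h3, h4⟩ := ih _ hlt _ (degree_of_mem_compress hne hA) rfl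
    refine ⟨A', h1, h2, h3.trans (card_compress hne A), h4.trans ?_⟩
    rw [← card_compress hne (shadow A)]
    exact card_le_card (shadow_compress_subset hne A)

theorem card_le_of_card_shadow_le {d : ℕ} {A : Finset (ℕ →₀ ℕ)} {κ : ℕ → ℕ}
    (hdeg : ∀ a ∈ A, a.degree = d + 2)
    (hle : #(shadow A) ≤ ∑ i ∈ range (d + 1), (κ i).choose (i + 1)) :
    #A ≤ ∑ i ∈ range (d + 1), (κ i + 1).choose (i + 2) := by
  obtain ⟨A', h1, h2, h3, h4⟩ := exists_isShifted _ _ A hdeg rfl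
  exact h3 ▸ h1.card_le h2 (h4.trans hle)

/-- Macaulay's theorem for sets of monomials. -/
theorem card_le_macaulayBound {d c : ℕ} (hd : 1 ≤ d) {A : Finset (ℕ →₀ ℕ)}
    (hdeg : ∀ a ∈ A, a.degree = d + 1) (hle : #(shadow A) ≤ c) : #A ≤ macaulayBound c d := by
  obtain ⟨d, rfl⟩ := Nat.exists_eq_add_of_le' hd
  rcases Nat.eq_zero_or_pos c with rfl | hc
  · rcases A.eq_empty_or_nonempty with rfl | h0
    · simp
    · have := card_pos.2 (shadow_nonempty hdeg h0)
      omega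
  obtain ⟨f, κ, h, -⟩ := exists_macaulayExpansion (d + 1) hd c hc
  have hsum (g : ℕ → ℕ) : ∑ i ∈ Finset.Icc f (d + 1), g i =
      ∑ i ∈ range (d + 1), if f ≤ i + 1 then g (i + 1) else 0 := by
    rw [range_eq_Ico, sum_Ico_add' (fun i ↦ if f ≤ i then g i else 0) 0 (d + 1) 1, ← sum_filter]
    refine sum_congr ?_ fun _ _ ↦ rfl
    have := h.one_le
    ext i
    simp only [mem_Icc, mem_filter, mem_Ico]
    omega
  rw [macaulayBound_eq h, hsum]
  rw [h.sum_eq, hsum] at hle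
  -- Indices below f get κ = 0: they contribute C(0, i + 1) = 0 to the hypothesis and C(1, i + 2) =
  -- 0 to the conclusion.
  refine (card_le_of_card_shadow_le (κ := fun i ↦ if f ≤ i + 1 then κ (i + 1) else 0) hdeg
    (hle.trans_eq ?_)).trans_eq ?_
  · refine sum_congr rfl fun i _ ↦ ?_
    split_ifs <;> simp
  · refine sum_congr rfl fun i _ ↦ ?_
    split_ifs
    · rfl
    · exact Nat.choose_eq_zero_of_lt (by omega)

end Shadow

/-! ### Members of an ordered family outside the span of the earlier ones. -/

section StandardMonomials

open Finsupp

variable {k : Type*} [Field k] {W ι L : Type*} [AddCommGroup W] [Module k W] [LinearOrder L]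

/-- The indices of the members of a family which are not in the span of the earlier members. -/
def standardIndices (k : Type*) [Field k] [Module k W] (r : ι → L) (f : ι → W) : Set ι :=
  {i | f i ∉ Submodule.span k (f '' {j | r j < r i})}

theorem linearIndepOn_standardIndices {r : ι → L} (hr : r.Injective) (f : ι → W) (s : Finset ι)
    (hs : ↑s ⊆ standardIndices k r f) : LinearIndepOn k f s := by
  classical
  let _ : LinearOrder ι := LinearOrder.lift' r hr
  induction s using Finset.induction_on_max with
  | empty => simp
  | insert a s ha ih =>
    rw [Finset.coe_insert] at hs ⊢
    refine LinearIndepOn.insert (ih fun i hi ↦ hs (Set.mem_insert_of_mem _ hi)) fun hmem ↦ ?_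
    refine hs (Set.mem_insert _ _) (Submodule.span_mono (Set.image_mono fun i hi ↦ ?_) hmem)
    exact ha i hi

/-- Well-founded induction: a member that is not standard lies in the span of earlier ones, which
are already covered. -/
theorem span_standardIndices [WellFoundedLT L] (r : ι → L) (f : ι → W) :
    Submodule.span k (f '' standardIndices k r f) = Submodule.span k (Set.range f) := by
  refine le_antisymm (Submodule.span_mono (Set.image_subset_range _ _)) ?_
  rw [Submodule.span_le]
  rintro _ ⟨i, rfl⟩
  induction h : r i using WellFoundedLT.induction generalizing i with
  | _ l ih =>
    subst h
    by_cases hi : i ∈ standardIndices k r f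
    · exact Submodule.subset_span ⟨i, hi, rfl⟩
    · have h1 : f i ∈ Submodule.span k (f '' {j | r j < r i}) := by
        by_contra hc
        exact hi hc
      refine Submodule.span_le.2 ?_ h1
      rintro _ ⟨j, hj, rfl⟩
      exact ih (r j) hj j rfl

end StandardMonomials

/-! ### Macaulay's theorem for graded modules generated in degree 0. -/

section GradedModule

open Finsupp

variable {k : Type*} [Field k] {σ : Type} {F : ℕ → Type*} [∀ n, AddCommGroup (F n)]
  [∀ n, Module k (F n)] (x : σ → ∀ n, F n →ₗ[k] F (n + 1))

open Classical in
/-- The product of a monomial of degree `n` with an element of degree `0`. If the degree of the monomial is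
not `n`, the value is `0`. -/
noncomputable def monomialMul : ∀ n, (σ →₀ ℕ) → F 0 → F n
  | 0, a, e => if a = 0 then e else 0
  | n + 1, a, e => if h : ∃ j, a j ≠ 0 then
      x h.choose n (monomialMul n (a - single h.choose 1) e) else 0

variable {x}

theorem exists_eq_add_single {a : σ →₀ ℕ} {j : σ} (h : a j ≠ 0) : ∃ b, a = b + single j 1 :=
  ⟨a - single j 1, by rw [tsub_add_cancel_of_le]; rw [Finsupp.single_le_iff]; omega⟩

theorem exists_monomialMul_succ_eq (n : ℕ) {a : σ →₀ ℕ} (h : a ≠ 0) (e : F 0) :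
    ∃ i b, a = b + single i 1 ∧ monomialMul x (n + 1) a e = x i n (monomialMul x n b e) := by
  have h : ∃ j, a j ≠ 0 := by
    by_contra! hc
    exact h (Finsupp.ext hc)
  refine ⟨h.choose, a - single h.choose 1, ?_, ?_⟩
  · obtain ⟨b, hb⟩ := exists_eq_add_single h.choose_spec
    generalize h.choose = i at hb
    rw [hb, add_tsub_cancel_right]
  · rw [monomialMul, dif_pos h]

/-- Commutation of the variables makes the product independent of the variable chosen at each stage.
In degree 0 a wrong choice can occur only for monomials of the wrong degree, where both sides
vanish. -/
theorem monomialMul_add_single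
    (comm : ∀ i j n f, x i (n + 1) (x j n f) = x j (n + 1) (x i n f)) (n : ℕ) (a : σ →₀ ℕ) (j : σ)
    (e : F 0) : monomialMul x (n + 1) (a + single j 1) e = x j n (monomialMul x n a e) := by
  induction n generalizing a j with
  | zero =>
    obtain ⟨i, b, hb, h⟩ := exists_monomialMul_succ_eq (x := x) 0 (a := a + single j 1)
      (fun h0 ↦ by simpa using DFunLike.congr_fun h0 j) e
    rw [h]
    by_cases hij : i = j
    · subst hij
      rw [add_right_cancel hb]
    · have ha : a ≠ 0 := by
        rintro rfl
        have := DFunLike.congr_fun hb i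
        simp [Ne.symm hij] at this
      have hb' : b ≠ 0 := by
        rintro rfl
        have := DFunLike.congr_fun hb j
        simp [hij] at this
      rw [monomialMul, monomialMul, if_neg ha, if_neg hb', map_zero, map_zero]
  | succ n ih =>
    obtain ⟨i, b, hb, h⟩ := exists_monomialMul_succ_eq (x := x) (n + 1) (a := a + single j 1)
      (fun h0 ↦ by simpa using DFunLike.congr_fun h0 j) e
    rw [h]
    by_cases hij : i = j
    · subst hij
      rw [add_right_cancel hb]
    · have ha : a i ≠ 0 := by
        intro h0
        have := DFunLike.congr_fun hb i
        simp [Ne.symm hij, h0] at this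
      obtain ⟨b', rfl⟩ := exists_eq_add_single ha
      rw [add_right_comm] at hb
      rw [← add_right_cancel hb, ih, ih, comm]

theorem degree_eq_of_monomialMul_ne_zero
    {n : ℕ} {a : σ →₀ ℕ} {e : F 0} (h : monomialMul x n a e ≠ 0) : a.degree = n := by
  induction n generalizing a with
  | zero =>
    rw [monomialMul] at h
    split_ifs at h with h0
    · simp [h0]
    · simp at h
  | succ n ih =>
    by_cases ha : a = 0
    · subst ha
      simp [monomialMul] at h
    · obtain ⟨i, b, rfl, hb⟩ := exists_monomialMul_succ_eq (x := x) n ha e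
      rw [hb] at h
      have := ih fun h1 ↦ h (by rw [h1, map_zero])
      simp [this]

theorem span_monomialMul (comm : ∀ i j n f, x i (n + 1) (x j n f) = x j (n + 1) (x i n f))
    (hgen : ∀ n, ⨆ j, LinearMap.range (x j n) = ⊤) (n : ℕ) :
    Submodule.span k (Set.range fun p : F 0 × (σ →₀ ℕ) ↦ monomialMul x n p.2 p.1) = ⊤ := by
  induction n with
  | zero =>
    refine top_le_iff.1 fun e _ ↦ Submodule.subset_span ⟨(e, 0), ?_⟩
    simp [monomialMul]
  | succ n ih =>
    rw [eq_top_iff, ← hgen n, iSup_le_iff]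
    intro j
    rw [LinearMap.range_eq_map, ← ih, Submodule.map_span, Submodule.span_le]
    rintro _ ⟨_, ⟨⟨e, a⟩, rfl⟩, rfl⟩
    refine Submodule.subset_span ⟨(e, a + single j 1), ?_⟩
    exact monomialMul_add_single comm n a j e

/-- Multiplication by x_j preserves the strict order of the pairs and sends V into ∑ x_i V, so it
carries a relation expressing e · x^a through smaller products to one for e · x^a x_j. -/
theorem mem_standardIndices_of_add_single {m : ℕ} {F : ℕ → Type*} [∀ n, AddCommGroup (F n)]
    [∀ n, Module k (F n)] {x : Fin m → ∀ n, F n →ₗ[k] F (n + 1)}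
    (comm : ∀ i j n f, x i (n + 1) (x j n f) = x j (n + 1) (x i n f)) [LinearOrder (F 0)]
    {d : ℕ} (V : Submodule k (F d)) {e : F 0} {a : Fin m →₀ ℕ} {j : Fin m}
    (h : (e, a + single j 1) ∈ standardIndices k
      (fun p : F 0 × (Fin m →₀ ℕ) ↦ toLex (p.1, MonomialOrder.lex.toSyn p.2))
      (fun p ↦ (⨆ j, V.map (x j d)).mkQ (monomialMul x (d + 1) p.2 p.1))) :
    (e, a) ∈ standardIndices k
      (fun p : F 0 × (Fin m →₀ ℕ) ↦ toLex (p.1, MonomialOrder.lex.toSyn p.2))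
      (fun p ↦ V.mkQ (monomialMul x d p.2 p.1)) := by
  by_contra hc
  refine h ?_
  simp only [standardIndices, Set.mem_ofPred_eq, not_not] at hc
  have hV : V ≤ (⨆ j, V.map (x j d)).comap (x j d) :=
    Submodule.map_le_iff_le_comap.1 (le_iSup (fun j ↦ V.map (x j d)) j)
  have := Submodule.mem_map_of_mem (f := V.mapQ _ (x j d) hV) hc
  rw [Submodule.map_span] at this
  simp only [Submodule.mkQ_apply, Submodule.mapQ_apply] at this ⊢
  rw [monomialMul_add_single comm]
  refine Submodule.span_mono ?_ this
  rintro _ ⟨_, ⟨⟨e', a'⟩, hlt, rfl⟩, rfl⟩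
  refine ⟨(e', a' + single j 1), ?_, ?_⟩
  · simp only [Set.mem_ofPred_eq, Prod.Lex.toLex_lt_toLex, map_add] at hlt ⊢
    rcases hlt with hlt | ⟨h1, h2⟩
    · exact Or.inl hlt
    · exact Or.inr ⟨h1, add_lt_add_left h2 _⟩
  · simp only [Submodule.mapQ_apply, monomialMul_add_single comm]

open Finset in
/-- Macaulay's theorem, for graded modules generated in degree `0`. -/
theorem rank_quotient_le_macaulayBound {m : ℕ} {F : ℕ → Type*} [∀ n, AddCommGroup (F n)]
    [∀ n, Module k (F n)] {x : Fin m → ∀ n, F n →ₗ[k] F (n + 1)}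
    (comm : ∀ i j n f, x i (n + 1) (x j n f) = x j (n + 1) (x i n f))
    (hgen : ∀ n, ⨆ j, LinearMap.range (x j n) = ⊤) {d c : ℕ} (hd : 1 ≤ d)
    (V : Submodule k (F d)) (hV : Module.rank k (F d ⧸ V) ≤ c) :
    Module.rank k (F (d + 1) ⧸ ⨆ j, V.map (x j d)) ≤ macaulayBound c d := by
  classical
  obtain ⟨hlin, hwf⟩ := exists_wellFoundedLT (F 0)
  let r : F 0 × (Fin m →₀ ℕ) → F 0 ×ₗ (MonomialOrder.lex (σ := Fin m)).syn :=
    fun p ↦ toLex (p.1, MonomialOrder.lex.toSyn p.2)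
  have hr : r.Injective := by
    rintro ⟨e, a⟩ ⟨e', a'⟩ h
    simpa [r] using h
  let f : F 0 × (Fin m →₀ ℕ) → F d ⧸ V := fun p ↦ V.mkQ (monomialMul x d p.2 p.1)
  let g : F 0 × (Fin m →₀ ℕ) → F (d + 1) ⧸ ⨆ j, V.map (x j d) :=
    fun p ↦ (⨆ j, V.map (x j d)).mkQ (monomialMul x (d + 1) p.2 p.1)
  have hg : Submodule.span k (g '' standardIndices k r g) = ⊤ := by
    rw [span_standardIndices]
    have : Set.range g = (⨆ j, V.map (x j d)).mkQ ''
        Set.range fun p : F 0 × (Fin m →₀ ℕ) ↦ monomialMul x (d + 1) p.2 p.1 := by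
      rw [← Set.range_comp]
      rfl
    rw [this, ← Submodule.map_span, span_monomialMul comm hgen, Submodule.map_top,
      Submodule.range_mkQ]
  rw [← rank_top, ← hg]
  refine (rank_span_le _).trans (Cardinal.mk_image_le.trans ?_)
  -- Bounding every finite subset of the standard pairs suffices, so F_0 may have infinite
  -- dimension.
  rw [Cardinal.mk_le_iff_forall_finset_subset_card_le]
  intro A hA
  have hdeg : ∀ p ∈ A, p.2.degree = d + 1 := by
    intro p hp
    refine degree_eq_of_monomialMul_ne_zero (x := x) (e := p.1) fun h0 ↦ hA hp ?_
    simp only [g, h0, map_zero]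
    exact zero_mem _
  -- Number the finitely many e that occur and give each its own variables. As the degree is d + 1 >
  -- 0, every monomial contains a variable, which reveals its e.
  obtain ⟨c', hc'⟩ := Set.countable_iff_exists_injOn.1 (A.image Prod.fst).countable_toSet
  let code : F 0 → Fin m → ℕ := fun e j ↦ Nat.pair j (c' e)
  let ψ : F 0 × (Fin m →₀ ℕ) → (ℕ →₀ ℕ) := fun p ↦ p.2.mapDomain (code p.1)
  have hcode : ∀ e, (code e).Injective := fun e j j' h ↦ by
    have := (Nat.pair_eq_pair.1 h).1
    exact Fin.ext this
  have hψ : Set.InjOn ψ A := by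
    rintro ⟨e, a⟩ ha ⟨e', a'⟩ ha' h
    have hne : a ≠ 0 := by
      rintro rfl
      simpa using hdeg _ ha
    obtain ⟨j, hj⟩ := Finsupp.support_nonempty_iff.2 hne
    have h1 : ψ (e, a) (code e j) ≠ 0 := by
      rw [Finsupp.mapDomain_apply (hcode e)]
      exact Finsupp.mem_support_iff.1 hj
    rw [h] at h1
    have h2 := Finsupp.mapDomain_support (Finsupp.mem_support_iff.2 h1)
    obtain ⟨j', -, hj'⟩ := Finset.mem_image.1 h2
    obtain rfl : e' = e := hc' (mem_coe.2 (mem_image_of_mem _ ha'))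
      (mem_coe.2 (mem_image_of_mem _ ha)) (Nat.pair_eq_pair.1 hj').2
    exact congrArg (Prod.mk e') (Finsupp.mapDomain_injective (hcode e') h)
  let S : Finset (F 0 × (Fin m →₀ ℕ)) :=
    A.biUnion fun p ↦ p.2.support.image fun j ↦ (p.1, p.2 - single j 1)
  have hS : ↑S ⊆ standardIndices k r f := by
    intro q hq
    rw [mem_coe, mem_biUnion] at hq
    obtain ⟨⟨e, a⟩, hp, hq⟩ := hq
    obtain ⟨j, hj, rfl⟩ := mem_image.1 hq
    obtain ⟨b, rfl⟩ := exists_eq_add_single (Finsupp.mem_support_iff.1 hj)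
    rw [add_tsub_cancel_right]
    exact mem_standardIndices_of_add_single comm V (hA hp)
  have hcard : #S ≤ c := by
    have h1 := (linearIndepOn_standardIndices hr f S hS).linearIndependent.cardinal_lift_le_rank
    simpa using h1.trans (Cardinal.lift_le.2 hV)
  rw [← card_image_of_injOn hψ]
  refine card_le_macaulayBound hd ?_ ?_
  · intro y hy
    obtain ⟨p, hp, rfl⟩ := mem_image.1 hy
    rw [← hdeg p hp]
    exact Finsupp.degree_mapDomain _ _
  · refine le_trans (card_le_card (t := S.image ψ) fun y hy ↦ ?_) (card_image_le.trans hcard)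
    obtain ⟨l, hl⟩ := mem_shadow.1 hy
    obtain ⟨⟨e, a⟩, hp, hpl⟩ := mem_image.1 hl
    have h1 : ψ (e, a) l ≠ 0 := by
      rw [hpl]
      simp
    obtain ⟨j, hj, rfl⟩ := mem_image.1 (Finsupp.mapDomain_support (Finsupp.mem_support_iff.2 h1))
    refine mem_image.2 ⟨(e, a - single j 1), mem_biUnion.2 ⟨_, hp, mem_image_of_mem _ hj⟩, ?_⟩
    obtain ⟨b, rfl⟩ := exists_eq_add_single (Finsupp.mem_support_iff.1 hj)
    simp only [ψ, Finsupp.mapDomain_add, Finsupp.mapDomain_single] at hpl ⊢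
    rw [add_tsub_cancel_right]
    exact add_right_cancel hpl

end GradedModule

/-! ### Koszul signs and the contracting homotopy. -/

section KoszulSign

variable {m : ℕ}

/-- The sign of the component `S ∪ {j} → S` of the differential of the Koszul complex. -/
def koszulSign (j : Fin m) (S : Finset (Fin m)) : ℤ := (-1) ^ (S.filter (· < j)).card

theorem koszulSign_mul_self (j : Fin m) (S : Finset (Fin m)) :
    koszulSign j S * koszulSign j S = 1 := by
  rw [koszulSign, ← pow_add, ← two_mul, pow_mul]
  simp

theorem koszulSign_insert {j l : Fin m} {S : Finset (Fin m)} (hl : l ∉ S) :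
    koszulSign j (insert l S) = if l < j then -koszulSign j S else koszulSign j S := by
  rw [koszulSign, koszulSign, Finset.filter_insert]
  split_ifs
  · rw [Finset.card_insert_of_notMem (by simp [hl]), pow_succ, mul_neg_one]
  · rfl

theorem koszulSign_mul_insert {i j : Fin m} {S : Finset (Fin m)} (hij : i ≠ j) (hi : i ∉ S)
    (hj : j ∉ S) : koszulSign j S * koszulSign i (insert j S) =
      -(koszulSign i S * koszulSign j (insert i S)) := by
  rw [koszulSign_insert hi, koszulSign_insert hj]
  rcases lt_or_gt_of_ne hij with h | h
  · rw [if_pos h, if_neg h.not_gt]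
    ring
  · rw [if_pos h, if_neg h.not_gt]
    ring

theorem koszulSign_insert_mul_insert {i j : Fin m} {S : Finset (Fin m)} (hij : i ≠ j) (hi : i ∉ S)
    (hj : j ∉ S) : koszulSign j (insert i S) * koszulSign i (insert j S) =
      -(koszulSign i S * koszulSign j S) := by
  rw [koszulSign_insert hi, koszulSign_insert hj]
  rcases lt_or_gt_of_ne hij with h | h
  · rw [if_pos h, if_neg h.not_gt]
    ring
  · rw [if_pos h, if_neg h.not_gt]
    ring

/-- If the multiplications by the variable `i` are bijective, then Koszul cycles are boundaries. The cycle
condition is only required at sets of the form `S \ {i}`. -/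
theorem koszul_contraction {A₂ A₁ A₀ : Type*} [AddCommGroup A₂] [AddCommGroup A₁] [AddCommGroup A₀]
    (x : Fin m → A₂ →+ A₁) (x' : Fin m → A₁ →+ A₀) (comm : ∀ i j y, x' i (x j y) = x' j (x i y))
    (i : Fin m) (hi : Function.Injective (x' i)) (a : Finset (Fin m) → A₁)
    (y : Finset (Fin m) → A₂) (hy : ∀ S, x i (y S) = a S) (S : Finset (Fin m))
    (cyc : i ∈ S → ∑ j, (if j ∈ S.erase i then 0 else
      koszulSign j (S.erase i) • x' j (a (insert j (S.erase i)))) = 0) :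
    (∑ j, if j ∈ S then 0 else koszulSign j S • x j (if i ∈ insert j S then
      koszulSign i ((insert j S).erase i) • y ((insert j S).erase i) else 0)) = a S := by
  by_cases hS : i ∈ S
  -- After applying the injective x'_i, the cycle condition at R = S \ {i} expresses x'_i (a S)
  -- through the a (R ∪ {j}) with j ≠ i. For i ∉ S only the summand j = i survives.
  · apply hi
    obtain ⟨R, hR, rfl⟩ : ∃ R, i ∉ R ∧ S = insert i R :=
      ⟨S.erase i, by simp, (Finset.insert_erase hS).symm⟩
    have cyc := cyc hS
    rw [Finset.erase_insert hR] at cyc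
    rw [← Finset.add_sum_erase _ _ (Finset.mem_univ i), if_neg hR] at cyc
    have h1 : x' i (a (insert i R)) = -(koszulSign i R • ∑ j ∈ Finset.univ.erase i,
        if j ∈ R then 0 else koszulSign j R • x' j (a (insert j R))) := by
      rw [← sub_eq_zero, sub_neg_eq_add]
      have := congrArg (koszulSign i R • ·) cyc
      simpa only [smul_add, smul_smul, koszulSign_mul_self, one_smul, smul_zero] using this
    rw [h1, map_sum, ← Finset.add_sum_erase _ _ (Finset.mem_univ i),
      if_pos (Finset.mem_insert_self _ _), map_zero, zero_add, Finset.smul_sum,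
      ← Finset.sum_neg_distrib]
    refine Finset.sum_congr rfl fun j hj ↦ ?_
    have hji : j ≠ i := Finset.ne_of_mem_erase hj
    by_cases hjR : j ∈ R
    · rw [if_pos hjR, if_pos (Finset.mem_insert_of_mem hjR), map_zero, smul_zero, neg_zero]
    · have h2 : (insert j (insert i R)).erase i = insert j R := by
        rw [Finset.insert_comm, Finset.erase_insert]
        simp [hR, hji.symm]
      rw [if_neg hjR, if_neg (by simp [hji, hjR]), if_pos (by simp), h2, map_zsmul, map_zsmul,
        map_zsmul, comm, hy, smul_smul, smul_smul, ← neg_smul,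
        koszulSign_insert_mul_insert hji.symm hR hjR]
  · rw [Finset.sum_eq_single i]
    · rw [if_neg hS, if_pos (Finset.mem_insert_self _ _), Finset.erase_insert hS, map_zsmul,
        smul_smul, koszulSign_mul_self, one_smul, hy]
    · intro j _ hji
      rw [if_neg (c := i ∈ insert j S), map_zero, smul_zero, ite_self]
      simp [hji.symm, hS]
    · simp

end KoszulSign

/-! ### The Koszul complex of commuting maps in a preadditive category. -/

section Koszul

open CategoryTheory Limits

universe v w

variable {C : Type w} [Category.{v} C] [Preadditive C] [HasFiniteBiproducts C] {m : ℕ}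

/-- The `p`-th term of the Koszul complex with coefficients in `A`: a sum of copies of `A`, indexed by the
`p`-element subsets of the set of variables. -/
noncomputable abbrev koszulTerm (m : ℕ) (A : C) (p : ℕ) : C :=
  ⨁ fun _ : {S : Finset (Fin m) // S.card = p} ↦ A

/-- The component at `S` of the `p`-th term of the Koszul complex, which is zero if `S` does not have `p`
elements. -/
noncomputable def koszulProj (A : C) (p : ℕ) (S : Finset (Fin m)) : koszulTerm m A p ⟶ A :=
  if h : S.card = p then biproduct.π _ ⟨S, h⟩ else 0

/-- The differential of the Koszul complex. -/
noncomputable def koszulD {A B : C} (x : Fin m → (A ⟶ B)) (p : ℕ) :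
    koszulTerm m A (p + 1) ⟶ koszulTerm m B p :=
  biproduct.lift fun S ↦ ∑ j, if j ∈ S.1 then 0 else
    koszulSign j S.1 • (koszulProj A (p + 1) (insert j S.1) ≫ x j)

theorem koszulD_proj {A B : C} (x : Fin m → (A ⟶ B)) (p : ℕ) (S : Finset (Fin m)) :
    koszulD x p ≫ koszulProj B p S = ∑ j, if j ∈ S then 0 else
      koszulSign j S • (koszulProj A (p + 1) (insert j S) ≫ x j) := by
  by_cases h : S.card = p
  · rw [koszulProj, dif_pos h, koszulD, biproduct.lift_π]
  · rw [koszulProj, dif_neg h, comp_zero]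
    refine (Finset.sum_eq_zero fun j _ ↦ ?_).symm
    split_ifs with hj
    · rfl
    · rw [koszulProj, dif_neg, zero_comp, smul_zero]
      rw [Finset.card_insert_of_notMem hj]
      omega

theorem koszulD_comp {A B D : C} {x : Fin m → (A ⟶ B)} {x' : Fin m → (B ⟶ D)}
    (comm : ∀ i j, x i ≫ x' j = x j ≫ x' i) (p : ℕ) : koszulD x (p + 1) ≫ koszulD x' p = 0 := by
  refine biproduct.hom_ext _ _ fun S ↦ ?_
  rw [zero_comp, Category.assoc]
  have h0 : biproduct.π (fun _ : {S : Finset (Fin m) // S.card = p} ↦ D) S = koszulProj D p S.1 := by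
    rw [koszulProj, dif_pos S.2]
  obtain ⟨S, hS⟩ := S
  rw [h0, koszulD_proj, Preadditive.comp_sum]
  have h1 : ∀ j, koszulD x (p + 1) ≫ (if j ∈ S then 0 else
      koszulSign j S • (koszulProj B (p + 1) (insert j S) ≫ x' j)) =
      ∑ i, if j ∈ S ∨ i ∈ insert j S then 0 else (koszulSign j S * koszulSign i (insert j S)) •
        (koszulProj A (p + 2) (insert i (insert j S)) ≫ x i ≫ x' j) := by
    intro j
    by_cases hj : j ∈ S
    · simp [hj]
    · simp only [hj, false_or, if_false]
      rw [Preadditive.comp_zsmul, ← Category.assoc, koszulD_proj, Preadditive.sum_comp,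
        Finset.smul_sum]
      refine Finset.sum_congr rfl fun i _ ↦ ?_
      split_ifs
      · simp
      · rw [Preadditive.zsmul_comp, smul_smul, Category.assoc]
  rw [Finset.sum_congr rfl fun j _ ↦ h1 j, ← Finset.sum_product']
  -- Removing i and j in the two orders gives the same map with opposite signs.
  refine Finset.sum_involution (fun q _ ↦ (q.2, q.1)) ?_ ?_ ?_ ?_
  · rintro ⟨j, i⟩ -
    simp only [Finset.mem_insert]
    by_cases hij : i = j
    · simp [hij]
    by_cases hi : i ∈ S
    · simp [hi]
    by_cases hj : j ∈ S
    · simp [hj]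
    rw [if_neg (by simp [hi, hj, hij]), if_neg (by simp [hi, hj, Ne.symm hij]), comm i j,
      Finset.insert_comm i j, koszulSign_mul_insert hij hi hj, neg_smul, neg_add_cancel]
  · rintro ⟨j, i⟩ - h heq
    obtain rfl : i = j := congrArg Prod.fst heq
    simp at h
  · simp
  · simp

section Exact

variable (G : C ⥤ AddCommGrpCat.{v}) [G.Additive]

theorem sum_hom_apply {ι : Type*} (t : Finset ι) {A B : AddCommGrpCat.{v}} (f : ι → (A ⟶ B)) (a : A) :
    (∑ j ∈ t, f j) a = ∑ j ∈ t, f j a := by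
  classical
  induction t using Finset.induction_on with
  | empty => rfl
  | insert j t hj ih =>
    rw [Finset.sum_insert hj, Finset.sum_insert hj, ← ih]
    rfl

/-- Additive functors preserve finite biproducts, so an element of the image of a Koszul term is
determined by its components. -/
theorem map_koszul_ext {A : C} {p : ℕ} {s t : G.obj (koszulTerm m A p)}
    (h : ∀ S : Finset (Fin m), S.card = p →
      G.map (koszulProj A p S) s = G.map (koszulProj A p S) t) : s = t := by
  have key : ∀ s : G.obj (koszulTerm m A p), s =
      ∑ S : {S : Finset (Fin m) // S.card = p}, G.map (biproduct.ι (fun _ ↦ A) S)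
        (G.map (koszulProj A p S.1) s) := by
    intro s
    have := congrArg (fun f ↦ G.map f s)
      (biproduct.total (f := fun _ : {S : Finset (Fin m) // S.card = p} ↦ A))
    simp only [G.map_sum, G.map_id, sum_hom_apply, G.map_comp] at this
    refine this.symm.trans (Finset.sum_congr rfl fun S _ ↦ ?_)
    rw [koszulProj, dif_pos S.2]
    rfl
  rw [key s, key t]
  exact Finset.sum_congr rfl fun S _ ↦ by rw [h _ S.2]

theorem exists_map_koszulProj_eq {A : C} {p : ℕ} (b : Finset (Fin m) → G.obj A)
    (hb : ∀ S, S.card ≠ p → b S = 0) :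
    ∃ t : G.obj (koszulTerm m A p), ∀ S, G.map (koszulProj A p S) t = b S := by
  refine ⟨∑ S : {S : Finset (Fin m) // S.card = p}, G.map (biproduct.ι (fun _ ↦ A) S) (b S.1),
    fun S ↦ ?_⟩
  by_cases hS : S.card = p
  · have h1 : ∀ R : {S : Finset (Fin m) // S.card = p}, G.map (koszulProj A p S)
        (G.map (biproduct.ι (fun _ ↦ A) R) (b R.1)) = if R = ⟨S, hS⟩ then b R.1 else 0 := by
      intro R
      rw [← ConcreteCategory.comp_apply, ← G.map_comp, koszulProj, dif_pos hS]
      split_ifs with h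
      · subst h
        rw [biproduct.ι_π_self, G.map_id]
        rfl
      · rw [biproduct.ι_π_ne _ h, G.map_zero]
        rfl
    rw [map_sum, Finset.sum_congr rfl fun R _ ↦ h1 R]
    simp
  · rw [koszulProj, dif_neg hS, G.map_zero, hb S hS]
    rfl

theorem map_koszulD_proj {A B : C} (x : Fin m → (A ⟶ B)) (p : ℕ) (S : Finset (Fin m))
    (s : G.obj (koszulTerm m A (p + 1))) :
    G.map (koszulProj B p S) (G.map (koszulD x p) s) = ∑ j, if j ∈ S then 0 else
      koszulSign j S • G.map (x j) (G.map (koszulProj A (p + 1) (insert j S)) s) := by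
  rw [← ConcreteCategory.comp_apply, ← G.map_comp, koszulD_proj, G.map_sum, sum_hom_apply]
  refine Finset.sum_congr rfl fun j _ ↦ ?_
  split_ifs
  · rw [G.map_zero]
    rfl
  · rw [G.map_zsmul, G.map_comp]
    rfl

theorem exists_map_koszulD_eq_of_sum_eq_zero {A B D : C} {x : Fin m → (A ⟶ B)}
    {x' : Fin m → (B ⟶ D)} (comm : ∀ i j, x i ≫ x' j = x j ≫ x' i) (i : Fin m)
    (hi : Function.Surjective (G.map (x i))) (hi' : Function.Injective (G.map (x' i))) (p : ℕ)
    (s : G.obj (koszulTerm m B p)) (hs : ∀ S : Finset (Fin m), S.card = p → i ∈ S →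
      ∑ j, (if j ∈ S.erase i then 0 else koszulSign j (S.erase i) •
        G.map (x' j) (G.map (koszulProj B p (insert j (S.erase i))) s)) = 0) :
    ∃ t, G.map (koszulD x p) t = s := by
  choose y hy using fun S ↦ hi (G.map (koszulProj B p S) s)
  -- Chosen preimages of zero need not be zero, so they are reset where S does not have p elements.
  let y' : Finset (Fin m) → G.obj A := fun S ↦ if S.card = p then y S else 0
  have hy' : ∀ S, G.map (x i) (y' S) = G.map (koszulProj B p S) s := by
    intro S
    by_cases hS : S.card = p
    · simp only [y', if_pos hS, hy]
    · simp only [y', if_neg hS, map_zero]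
      rw [koszulProj, dif_neg hS, G.map_zero]
      rfl
  obtain ⟨t, ht⟩ := exists_map_koszulProj_eq G (p := p + 1)
    (fun S ↦ if i ∈ S then koszulSign i (S.erase i) • y' (S.erase i) else 0) (by
      intro S hS
      simp only [y']
      split_ifs with h1 h2
      · have := Finset.card_erase_add_one h1
        omega
      · simp
      · rfl)
  refine ⟨t, map_koszul_ext G fun S hS ↦ ?_⟩
  rw [map_koszulD_proj]
  simp only [ht]
  refine koszul_contraction (fun j ↦ (G.map (x j)).hom) (fun j ↦ (G.map (x' j)).hom) ?_ i hi'
    (fun S ↦ G.map (koszulProj B p S) s) y' hy' S (hs S hS)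
  intro i j y
  have := congrArg (fun f ↦ G.map f y) (comm j i)
  simpa only [G.map_comp, ConcreteCategory.comp_apply] using this

/-- A criterion for the Koszul complex to be exact after applying an additive functor. -/
theorem exists_map_koszulD_eq {A B D : C} {x : Fin m → (A ⟶ B)} {x' : Fin m → (B ⟶ D)}
    (comm : ∀ i j, x i ≫ x' j = x j ≫ x' i) (i : Fin m)
    (hi : Function.Surjective (G.map (x i))) (hi' : Function.Injective (G.map (x' i))) (p : ℕ)
    (s : G.obj (koszulTerm m B (p + 1))) (hs : G.map (koszulD x' p) s = 0) :
    ∃ t, G.map (koszulD x (p + 1)) t = s := by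
  refine exists_map_koszulD_eq_of_sum_eq_zero G comm i hi hi' _ s fun S _ _ ↦ ?_
  rw [← map_koszulD_proj, hs, map_zero]

/-- At the end of the complex the cycle condition is vacuous: the only index set is ∅, which does
not contain i. -/
theorem map_koszulD_zero_surjective {A B D : C} {x : Fin m → (A ⟶ B)} {x' : Fin m → (B ⟶ D)}
    (comm : ∀ i j, x i ≫ x' j = x j ≫ x' i) (i : Fin m)
    (hi : Function.Surjective (G.map (x i))) (hi' : Function.Injective (G.map (x' i))) :
    Function.Surjective (G.map (koszulD x 0)) := fun s ↦ by
  refine exists_map_koszulD_eq_of_sum_eq_zero G comm i hi hi' _ s fun S hS hi ↦ ?_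
  rw [Finset.card_eq_zero.1 hS] at hi
  exact absurd hi (Finset.notMem_empty i)

end Exact

end Koszul

/-! ### Dimension shifting for Ext along a bounded exact complex. -/

section DimensionShift

open CategoryTheory Limits Abelian

universe v w w'

variable {C : Type w} [Category.{v} C] [Abelian C]

theorem isZero_koszulTerm (A : C) [HasFiniteBiproducts C] {m p : ℕ} (h : m < p) :
    IsZero (koszulTerm m A p) := by
  rw [IsZero.iff_id_eq_zero]
  refine biproduct.hom_ext _ _ fun S ↦ ?_
  have := Finset.card_le_univ S.1
  rw [S.2, Fintype.card_fin] at this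
  omega

variable {K : ℕ → C} {d : ∀ p, K (p + 1) ⟶ K p} (w : ∀ p, d (p + 1) ≫ d p = 0)

theorem shortExact_kernel_lift (j : ℕ) (hex : (ShortComplex.mk _ _ (w j)).Exact) :
    (ShortComplex.mk (kernel.ι (d (j + 1))) (kernel.lift (d j) (d (j + 1)) (w j))
      (by rw [← cancel_mono (kernel.ι (d j))]; simp)).ShortExact where
  exact := by
    let S := ShortComplex.mk (kernel.ι (d (j + 1))) (kernel.lift (d j) (d (j + 1)) (w j))
      (by rw [← cancel_mono (kernel.ι (d j))]; simp)
    let S' := ShortComplex.mk (kernel.ι (d (j + 1))) (d (j + 1)) (kernel.condition _)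
    let φ : S ⟶ S' :=
      { τ₁ := 𝟙 _
        τ₂ := 𝟙 _
        τ₃ := kernel.ι (d j)
        comm₁₂ := by simp [S, S']
        comm₂₃ := by simp [S, S'] }
    have : Epi φ.τ₁ := inferInstanceAs (Epi (𝟙 _))
    have : IsIso φ.τ₂ := inferInstanceAs (IsIso (𝟙 _))
    have : Mono φ.τ₃ := inferInstanceAs (Mono (kernel.ι _))
    rw [ShortComplex.exact_iff_of_epi_of_isIso_of_mono φ]
    exact ShortComplex.exact_of_f_is_kernel _ (kernelIsKernel _)
  mono_f := inferInstanceAs (Mono (kernel.ι _))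
  epi_g := (ShortComplex.exact_iff_epi_kernel_lift _).1 hex

section Ext

variable [HasExt.{w'} C] {P : C}

theorem ext_eq_zero_of_isZero {A : C} (hA : IsZero A) {n : ℕ} (y : Ext P A n) : y = 0 := by
  rw [← y.comp_mk₀_id, hA.eq_of_src (𝟙 A) 0, Ext.mk₀_zero, Ext.comp_zero]

theorem ext_koszulTerm_eq_zero {A : C} [HasFiniteBiproducts C] {n : ℕ} (hA : ∀ y : Ext P A n, y = 0)
    (m p : ℕ) (y : Ext P (koszulTerm m A p) n) : y = 0 := by
  rw [← y.comp_mk₀_id, ← biproduct.total, Ext.mk₀_sum, Ext.comp_sum]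
  refine Finset.sum_eq_zero fun S _ ↦ ?_
  rw [← Ext.mk₀_comp_mk₀, ← Ext.comp_assoc_of_third_deg_zero, hA (y.comp _ _), Ext.zero_comp]

/-- Dimension shifting along a bounded exact complex. -/
theorem ext_kernel_eq_zero (hex : ∀ p, (ShortComplex.mk _ _ (w p)).Exact) {b : ℕ}
    (hb : ∀ p, b < p → IsZero (K p)) (r : ℕ) : ∀ j q, j + r = b →
    (∀ p n, j + 2 ≤ p → p + q = j + 2 + n → ∀ y : Ext P (K p) n, y = 0) →
    ∀ y : Ext P (kernel (d j)) q, y = 0 := by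
  induction r with
  | zero =>
    intro j q hj _ y
    -- The descending induction starts at j = b, where the kernel is a subobject of K (b + 1) = 0.
    exact ext_eq_zero_of_isZero (IsZero.of_mono (kernel.ι (d j)) (hb _ (by omega))) y
  | succ r ih =>
    intro j q hj h y
    have hS := shortExact_kernel_lift w j (hex j)
    obtain ⟨y₂, hy₂⟩ := Ext.covariant_sequence_exact₃ P hS y rfl
      (ih (j + 1) (q + 1) (by omega) (fun p n hp hn ↦ h p n (by omega) (by omega)) _)
    rw [← hy₂, h (j + 2) q le_rfl rfl y₂, Ext.zero_comp]

theorem exists_comp_mk₀_eq (hex : ∀ p, (ShortComplex.mk _ _ (w p)).Exact) (hepi : Epi (d 0)) {b : ℕ}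
    (hb : ∀ p, b < p → IsZero (K p)) (q : ℕ)
    (h : ∀ p n, 2 ≤ p → p + q = n + 1 → ∀ y : Ext P (K p) n, y = 0) (y : Ext P (K 0) q) :
    ∃ y' : Ext P (K 1) q, y'.comp (Ext.mk₀ (d 0)) (add_zero q) = y := by
  have hS : (ShortComplex.mk (kernel.ι (d 0)) (d 0) (kernel.condition _)).ShortExact :=
    { exact := ShortComplex.exact_of_f_is_kernel _ (kernelIsKernel _)
      mono_f := inferInstanceAs (Mono (kernel.ι _))
      epi_g := hepi }
  exact Ext.covariant_sequence_exact₃ P hS y rfl <|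
    ext_kernel_eq_zero w hex hb b 0 (q + 1) (zero_add b)
      (fun p n hp hn ↦ h p n (by omega) (by omega)) _

end Ext

end DimensionShift

/-! ### Exactness of sheaf sequences from sections over small open sets. -/

section LocalExactness

open CategoryTheory Limits TopologicalSpace Opposite

variable {X : TopCat.{u}}

/-- Sections over an open subset, as a functor on sheaves. -/
noncomputable abbrev sectionsFunctor (U : Opens X) :
    Sheaf (Opens.grothendieckTopology X) AddCommGrpCat.{u} ⥤ AddCommGrpCat.{u} :=
  sheafToPresheaf _ _ ⋙ (evaluation _ _).obj (op U)

instance (U : Opens X) : (sectionsFunctor U).Additive where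

theorem epi_of_locally_surjective
    {A B : Sheaf (Opens.grothendieckTopology X) AddCommGrpCat.{u}} (f : A ⟶ B)
    (h : ∀ x : X, ∃ U : Opens X, x ∈ U ∧ ∀ V ≤ U, Function.Surjective ((sectionsFunctor V).map f)) :
    Epi f := by
  refine (TopCat.Sheaf.isLocallySurjective_iff_epi (X := X) (F := A) (G := B) f).1 ?_
  rw [TopCat.Presheaf.isLocallySurjective_iff]
  intro W t x hx
  obtain ⟨U, hxU, hU⟩ := h x
  obtain ⟨s, hs⟩ := hU (W ⊓ U) inf_le_right (B.obj.map (homOfLE inf_le_left).op t)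
  exact ⟨W ⊓ U, inf_le_left, ⟨s, hs⟩, hx, hxU⟩

theorem exact_of_locally_exact
    (S : ShortComplex (Sheaf (Opens.grothendieckTopology X) AddCommGrpCat.{u}))
    (h : ∀ x : X, ∃ U : Opens X, x ∈ U ∧ ∀ V ≤ U, ∀ s, (sectionsFunctor V).map S.g s = 0 →
      ∃ t, (sectionsFunctor V).map S.f t = s) : S.Exact := by
  rw [ShortComplex.exact_iff_epi_kernel_lift]
  refine epi_of_locally_surjective _ fun x ↦ ?_
  obtain ⟨U, hxU, hU⟩ := h x
  refine ⟨U, hxU, fun V hV s ↦ ?_⟩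
  have hinj : Function.Injective ((sectionsFunctor V).map (kernel.ι S.g)) :=
    (AddCommGrpCat.mono_iff_injective _).1 inferInstance
  obtain ⟨t, ht⟩ := hU V hV ((sectionsFunctor V).map (kernel.ι S.g) s) (by
    rw [← ConcreteCategory.comp_apply, ← Functor.map_comp, kernel.condition, Functor.map_zero]
    rfl)
  refine ⟨t, hinj ?_⟩
  rw [← ht, ← ConcreteCategory.comp_apply, ← Functor.map_comp, kernel.lift_ι]

end LocalExactness

/-! ### Mumford's lemma for a sequence of sheaves with commuting, locally invertible maps. -/

section Regularity

open CategoryTheory Limits TopologicalSpace Opposite Abelian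

attribute [local instance] Abelian.hasFiniteBiproducts

variable {X : TopCat.{u}} {m : ℕ} {T : ℤ → Sheaf (Opens.grothendieckTopology X) AddCommGrpCat.{u}}
  {x : Fin m → ∀ {a b : ℤ}, a + 1 = b → (T a ⟶ T b)}

theorem exact_koszulD
    (comm : ∀ i j {a b c : ℤ} (h : a + 1 = b) (h' : b + 1 = c), x i h ≫ x j h' = x j h ≫ x i h')
    (hbij : ∀ q : X, ∃ (i : Fin m) (U : Opens X), q ∈ U ∧ ∀ V ≤ U, ∀ (a b : ℤ) (h : a + 1 = b),
      Function.Bijective ((sectionsFunctor V).map (x i h)))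
    {a b c : ℤ} (h : a + 1 = b) (h' : b + 1 = c) (p : ℕ) :
    (ShortComplex.mk (koszulD (fun j ↦ x j h) (p + 1)) (koszulD (fun j ↦ x j h') p)
      (koszulD_comp (fun i j ↦ comm i j h h') p)).Exact := by
  refine exact_of_locally_exact _ fun q ↦ ?_
  obtain ⟨i, U, hq, hU⟩ := hbij q
  exact ⟨U, hq, fun V hV s hs ↦ exists_map_koszulD_eq (sectionsFunctor V)
    (fun i j ↦ comm i j h h') i (hU V hV a b h).2 (hU V hV b c h').1 p s hs⟩

theorem epi_koszulD_zero
    (comm : ∀ i j {a b c : ℤ} (h : a + 1 = b) (h' : b + 1 = c), x i h ≫ x j h' = x j h ≫ x i h')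
    (hbij : ∀ q : X, ∃ (i : Fin m) (U : Opens X), q ∈ U ∧ ∀ V ≤ U, ∀ (a b : ℤ) (h : a + 1 = b),
      Function.Bijective ((sectionsFunctor V).map (x i h)))
    {a b : ℤ} (h : a + 1 = b) : Epi (koszulD (fun j ↦ x j h) 0) := by
  refine epi_of_locally_surjective _ fun q ↦ ?_
  obtain ⟨i, U, hq, hU⟩ := hbij q
  exact ⟨U, hq, fun V hV ↦ map_koszulD_zero_surjective (sectionsFunctor V)
    (fun i j ↦ comm i j h rfl) i (hU V hV a b h).2 (hU V hV b _ rfl).1⟩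

/-- The p-th Koszul term is a sum of copies of T (b - p). The obstruction to lifting is killed by
Ext^l of the terms with p ≥ 2 and l = p + q - 1; there b - p = n - l, which is exactly what
regularity covers. Taking q > 0 propagates regularity, and q = 0 gives generation by sections. -/
theorem exists_comp_koszulD_zero_eq
    (comm : ∀ i j {a b c : ℤ} (h : a + 1 = b) (h' : b + 1 = c), x i h ≫ x j h' = x j h ≫ x i h')
    (hbij : ∀ q : X, ∃ (i : Fin m) (U : Opens X), q ∈ U ∧ ∀ V ≤ U, ∀ (a b : ℤ) (h : a + 1 = b),
      Function.Bijective ((sectionsFunctor V).map (x i h)))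
    {P : Sheaf (Opens.grothendieckTopology X) AddCommGrpCat.{u}} {n : ℤ}
    (hreg : ∀ i : ℕ, 0 < i → ∀ y : Ext P (T (n - i)) i, y = 0) (q : ℕ) {a b : ℤ} (h : a + 1 = b)
    (ha : a = n - q) (y : Ext P (koszulTerm m (T b) 0) q) :
    ∃ y' : Ext P (koszulTerm m (T a) 1) q,
      y'.comp (Ext.mk₀ (koszulD (fun j ↦ x j h) 0)) (add_zero q) = y := by
  obtain rfl : a = b - (1 : ℕ) := by push_cast; omega
  have hstep (p : ℕ) : b - (p + 1 : ℕ) + 1 = b - p := by push_cast; omega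
  have hb : b - (0 : ℕ) = b := by simp
  have key := exists_comp_mk₀_eq (P := P) (K := fun p ↦ koszulTerm m (T (b - p)) p)
    (d := fun p ↦ koszulD (fun j ↦ x j (hstep p)) p)
    (fun p ↦ koszulD_comp (fun i j ↦ comm i j _ _) p) (fun p ↦ exact_koszulD comm hbij _ _ p)
    (epi_koszulD_zero comm hbij _) (b := m) (fun p hp ↦ isZero_koszulTerm _ hp) q (by
      intro p l hp hpl
      refine ext_koszulTerm_eq_zero ?_ _ _
      obtain rfl : p = l + 1 - q := by omega
      rw [show b - (l + 1 - q : ℕ) = n - l by omega]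
      exact hreg l (by omega))
  revert y
  -- Transports the result from T (b - 0) to T b.
  have h0 : ∀ b' (hb' : b' = b) (h : b - (1 : ℕ) + 1 = b'),
      (∀ y : Ext P (koszulTerm m (T b') 0) q, ∃ y' : Ext P (koszulTerm m (T (b - (1 : ℕ))) 1) q,
        y'.comp (Ext.mk₀ (koszulD (fun j ↦ x j h) 0)) (add_zero q) = y) →
      ∀ y : Ext P (koszulTerm m (T b) 0) q, ∃ y' : Ext P (koszulTerm m (T (b - (1 : ℕ))) 1) q,
        y'.comp (Ext.mk₀ (koszulD (fun j ↦ x j (h.trans hb')) 0)) (add_zero q) = y := by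
    rintro _ rfl _ h
    exact h
  exact h0 _ hb _ key

theorem koszulTerm_zero_ι_proj {C : Type*} [Category* C] [Preadditive C] [HasFiniteBiproducts C] (A : C) :
    biproduct.ι (fun _ : {S : Finset (Fin m) // S.card = 0} ↦ A) ⟨∅, rfl⟩ ≫ koszulProj A 0 ∅ = 𝟙 A := by
  rw [koszulProj, dif_pos Finset.card_empty, biproduct.ι_π_self]

/-- The class lifts to Ext^i of a sum of copies of T (n - i), which vanishes. The index set of the
zeroth Koszul term is {∅}, so T (n + 1 - i) is a retract of it. -/
theorem regular_succ
    (comm : ∀ i j {a b c : ℤ} (h : a + 1 = b) (h' : b + 1 = c), x i h ≫ x j h' = x j h ≫ x i h')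
    (hbij : ∀ q : X, ∃ (i : Fin m) (U : Opens X), q ∈ U ∧ ∀ V ≤ U, ∀ (a b : ℤ) (h : a + 1 = b),
      Function.Bijective ((sectionsFunctor V).map (x i h)))
    {P : Sheaf (Opens.grothendieckTopology X) AddCommGrpCat.{u}} {n : ℤ}
    (hreg : ∀ i : ℕ, 0 < i → ∀ y : Ext P (T (n - i)) i, y = 0) (i : ℕ) (hi : 0 < i)
    (y : Ext P (T (n + 1 - i)) i) : y = 0 := by
  obtain ⟨y', hy'⟩ := exists_comp_koszulD_zero_eq comm hbij hreg i (a := n - i) (b := n + 1 - i)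
    (by omega) rfl
    (y.comp (Ext.mk₀ (biproduct.ι (fun _ : {S : Finset (Fin m) // S.card = 0} ↦ T (n + 1 - i))
      ⟨∅, rfl⟩)) (add_zero i))
  rw [ext_koszulTerm_eq_zero (hreg i hi) _ _ y', Ext.zero_comp] at hy'
  rw [← y.comp_mk₀_id, ← koszulTerm_zero_ι_proj (m := m), ← Ext.mk₀_comp_mk₀,
    ← Ext.comp_assoc_of_third_deg_zero, ← hy', Ext.zero_comp]

theorem regular_add
    (comm : ∀ i j {a b c : ℤ} (h : a + 1 = b) (h' : b + 1 = c), x i h ≫ x j h' = x j h ≫ x i h')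
    (hbij : ∀ q : X, ∃ (i : Fin m) (U : Opens X), q ∈ U ∧ ∀ V ≤ U, ∀ (a b : ℤ) (h : a + 1 = b),
      Function.Bijective ((sectionsFunctor V).map (x i h)))
    {P : Sheaf (Opens.grothendieckTopology X) AddCommGrpCat.{u}}
    (hreg : ∀ i : ℕ, 0 < i → ∀ y : Ext P (T (-i)) i, y = 0) (n : ℕ) :
    ∀ i : ℕ, 0 < i → ∀ y : Ext P (T (n - i)) i, y = 0 := by
  induction n with
  | zero =>
    intro i hi
    rw [show ((0 : ℕ) : ℤ) - i = -i by simp]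
    exact hreg i hi
  | succ n ih => exact regular_succ comm hbij ih

/-- If the sheaves `T n` are regular, then the global sections of `T (n + 1)` are sums of multiples of global
sections of `T n`. -/
theorem exists_sum_eq
    (comm : ∀ i j {a b c : ℤ} (h : a + 1 = b) (h' : b + 1 = c), x i h ≫ x j h' = x j h ≫ x i h')
    (hbij : ∀ q : X, ∃ (i : Fin m) (U : Opens X), q ∈ U ∧ ∀ V ≤ U, ∀ (a b : ℤ) (h : a + 1 = b),
      Function.Bijective ((sectionsFunctor V).map (x i h)))
    (hreg : ∀ i : ℕ, 0 < i → ∀ y : Sheaf.H (T (-i)) i, y = 0) (n : ℕ) {b : ℤ} (h : (n : ℤ) + 1 = b)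
    (s : (sectionsFunctor ⊤).obj (T b)) :
    ∃ t : Fin m → (sectionsFunctor ⊤).obj (T n), ∑ j, (sectionsFunctor ⊤).map (x j h) (t j) = s := by
  let ι := biproduct.ι (fun _ : {S : Finset (Fin m) // S.card = 0} ↦ T b) ⟨∅, rfl⟩
  have hT : IsTerminal (⊤ : Opens X) := isTerminalTop
  obtain ⟨y, hy⟩ := exists_comp_koszulD_zero_eq comm hbij (regular_add comm hbij hreg n) 0 h
    (by simp) ((Sheaf.H.equiv₀ _ hT).symm ((sectionsFunctor ⊤).map ι s))
  have h1 : (sectionsFunctor ⊤).map (koszulD (fun j ↦ x j h) 0) (Sheaf.H.equiv₀ _ hT y) =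
      (sectionsFunctor ⊤).map ι s := by
    have := congrArg (Sheaf.H.equiv₀ _ hT) hy
    rwa [AddEquiv.apply_symm_apply, ← Sheaf.H.map_apply, ← Sheaf.H.equiv₀_naturality] at this
  have h2 : (sectionsFunctor ⊤).map (koszulProj (T b) 0 ∅) ((sectionsFunctor ⊤).map ι s) = s := by
    rw [← ConcreteCategory.comp_apply, ← Functor.map_comp, koszulTerm_zero_ι_proj, CategoryTheory.Functor.map_id]
    rfl
  rw [← h1] at h2
  have h3 := map_koszulD_proj (sectionsFunctor ⊤) (fun j ↦ x j h) 0 ∅ (Sheaf.H.equiv₀ _ hT y)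
  rw [h2] at h3
  simp only [Finset.notMem_empty, if_false, koszulSign, Finset.filter_empty, Finset.card_empty,
    pow_zero, one_smul] at h3
  exact ⟨_, h3.symm⟩

end Regularity

open CategoryTheory AlgebraicGeometry TopologicalSpace Opposite

noncomputable section

/-! ### The coordinates of projective space as maps between Serre twists. -/

section Coordinates

variable (k : Type u) [Field k] (N : ℕ)

theorem mk_mul_mk_cancel {A : Type*} [CommRing A] (S : Submonoid A) {a b c : A} (ha : a ∈ S)
    (hb : b ∈ S) :
    (Localization.mk a ⟨b ^ 1, pow_mem hb 1⟩ * Localization.mk c ⟨a ^ 1, pow_mem ha 1⟩ :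
      Localization S) = Localization.mk c ⟨b ^ 1, pow_mem hb 1⟩ := by
  rw [Localization.mk_mul, Localization.mk_eq_mk_iff, Localization.r_iff_exists]
  exact ⟨1, by simp [mul_comm, mul_left_comm]⟩

theorem ratio_mul_ratio_cancel (i j l : Fin (N + 1)) :
    (resO inf_le_right (ratio k N i l) : Γ(ProjSpace k N, chart k N i ⊓ chart k N l)) *
      resO inf_le_left (ratio k N j i) = resO inf_le_right (ratio k N j l) := by
  apply Subtype.ext
  funext x
  apply HomogeneousLocalization.val_injective
  let y : ProjectiveSpectrum (grading k N) := x.1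
  have : y.asHomogeneousIdeal.toIdeal.IsPrime := y.isPrime
  have h := mk_mul_mk_cancel (y.asHomogeneousIdeal.toIdeal.primeCompl) (c := MvPolynomial.X j)
    x.2.1 x.2.2
  refine Eq.trans (Eq.trans ?_ h) ?_
  · refine (HomogeneousLocalization.val_mul (𝒜 := grading k N)
      (x := y.asHomogeneousIdeal.toIdeal.primeCompl) _ _).trans ?_
    congr 1
  · rfl

variable {k N} in
theorem ratio_mul_ratio_cancel_of_le (i j l : Fin (N + 1)) {W : (ProjSpace k N).Opens}
    (hi : W ≤ chart k N i) (hl : W ≤ chart k N l) :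
    (resO hl (ratio k N i l) : Γ(ProjSpace k N, W)) * resO hi (ratio k N j i) =
      resO hl (ratio k N j l) := by
  have := congrArg (resO (le_inf hi hl)) (ratio_mul_ratio_cancel k N i j l)
  rwa [map_mul, resO_resO, resO_resO, resO_resO] at this

variable {k N} in
theorem ratio_mul_ratio_of_le (i j : Fin (N + 1)) {W : (ProjSpace k N).Opens}
    (hi : W ≤ chart k N i) (hj : W ≤ chart k N j) :
    (resO hj (ratio k N i j) : Γ(ProjSpace k N, W)) * resO hi (ratio k N j i) = 1 := by
  have := congrArg (resO (le_inf hi hj)) (ratio_mul_ratio k N i j)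
  rwa [map_mul, resO_resO, resO_resO, map_one] at this

theorem transition_one (i j : Fin (N + 1)) :
    transition k N 1 i j = resO inf_le_right (ratio k N i j) := by
  rw [transition, zpow_one]
  rfl

theorem transition_neg_one (i j : Fin (N + 1)) :
    transition k N (-1) i j = resO inf_le_left (ratio k N j i) := by
  rw [transition, zpow_neg_one]
  rfl

/-- The coordinate `x_j`, as a section of `𝒪(1)` over `U`. -/
def coordSection (j : Fin (N + 1)) (U : (ProjSpace k N).Opens) :
    twistSections (chart k N) (transition k N 1) (structureModule k N) U :=
  ⟨fun i ↦ (resO inf_le_right (ratio k N j i) : Γ(ProjSpace k N, U ⊓ chart k N i)),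
    (mem_twistSections _ _).2 fun i l ↦ by
      change (resO _ (resO _ _) : Γ(ProjSpace k N, _)) = transOn _ _ _ _ _ * resO _ (resO _ _)
      rw [transOn, transition_one, resO_resO, resO_resO, resO_resO]
      exact (ratio_mul_ratio_cancel_of_le i j l _ _).symm⟩

/-- The inverse of the coordinate `x_j`, as a section of `𝒪(-1)` over an open subset of `D₊(x_j)`. -/
def invCoordSection (j : Fin (N + 1)) {U : (ProjSpace k N).Opens} (hU : U ≤ chart k N j) :
    twistSections (chart k N) (transition k N (-1)) (structureModule k N) U :=
  ⟨fun i ↦ (resO (inf_le_left.trans hU) (ratio k N i j) : Γ(ProjSpace k N, U ⊓ chart k N i)),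
    (mem_twistSections _ _).2 fun i l ↦ by
      change (resO _ (resO _ _) : Γ(ProjSpace k N, _)) = transOn _ _ _ _ _ * resO _ (resO _ _)
      rw [transOn, transition_neg_one, resO_resO, resO_resO, resO_resO]
      exact ((mul_comm _ _).trans (ratio_mul_ratio_cancel_of_le i l j _ _)).symm⟩

variable {k N}

theorem transition_of_add_eq {a e b : ℤ} (h : a + e = b) (i j : Fin (N + 1)) :
    transition k N b i j = transition k N a i j * transition k N e i j := by
  rw [← h, transition_add]

variable (M : (ProjSpace k N).Modules)

/-- The underlying sheaf of abelian groups of `M(n)`. -/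
abbrev twistSheaf (n : ℤ) : Sheaf (Opens.grothendieckTopology (ProjSpace k N)) AddCommGrpCat.{u} :=
  (SheafOfModules.toSheaf (ProjSpace k N).ringCatSheaf).obj (serreTwist M n)

/-- Multiplication by the coordinate `x_j`, as a map of sheaves `M(a) → M(a + 1)`. -/
def mulCoord (j : Fin (N + 1)) {a b : ℤ} (h : a + 1 = b) : twistSheaf M a ⟶ twistSheaf M b where
  hom :=
    { app U := AddCommGrpCat.ofHom
        { toFun s := (twistMul (chart k N) (transition_of_add_eq h) (M := M) (U := U.unop) s
            (coordSection k N j U.unop) : twistSections (chart k N) (transition k N b) M U.unop)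
          map_zero' := twist_ext (M := M) _ _ fun i ↦ smul_zero _
          map_add' s t := twist_ext (M := M) _ _ fun i ↦ smul_add _ _ _ }
      naturality U V f := by
        ext s
        refine twist_ext (M := M) _ _ fun i ↦ ?_
        exact ((res_smul M _ _ _).trans (congrArg (· • _) (resO_resO _ _ _))).symm }

theorem mulCoord_comm (i j : Fin (N + 1)) {a b c : ℤ} (h : a + 1 = b) (h' : b + 1 = c) :
    mulCoord M i h ≫ mulCoord M j h' = mulCoord M j h ≫ mulCoord M i h' := by
  ext U s
  refine twist_ext (M := M) _ _ fun l ↦ ?_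
  exact smul_comm _ _ _

/-- On D₊(x_j) the coordinate is invertible, and multiplication by the section x_j⁻¹ of 𝒪(-1) is the
inverse. -/
theorem mulCoord_bijective (j : Fin (N + 1)) {a b : ℤ} (h : a + 1 = b) {U : (ProjSpace k N).Opens}
    (hU : U ≤ chart k N j) : Function.Bijective ((sectionsFunctor U).map (mulCoord M j h)) := by
  have h1 (i : Fin (N + 1)) : (resO (inf_le_left.trans hU) (ratio k N i j) :
      Γ(ProjSpace k N, U ⊓ chart k N i)) * resO inf_le_right (ratio k N j i) = 1 :=
    ratio_mul_ratio_of_le i j _ _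
  let inv : twistSections (chart k N) (transition k N b) M U →
      twistSections (chart k N) (transition k N a) M U := fun t ↦
    twistMul (chart k N) (transition_of_add_eq (by omega)) t (invCoordSection k N j hU)
  refine Function.bijective_iff_has_inverse.2 ⟨inv, fun s ↦ ?_, fun s ↦ ?_⟩
  · refine twist_ext (M := M) _ _ fun i ↦ ?_
    refine (smul_smul _ _ _).trans ?_
    exact (congrArg (· • _) (h1 i)).trans (one_smul _ _)
  · refine twist_ext (M := M) _ _ fun i ↦ ?_
    refine (smul_smul _ _ _).trans ?_
    exact (congrArg (· • _) ((mul_comm _ _).trans (h1 i))).trans (one_smul _ _)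

theorem exists_mem_chart (q : ProjSpace k N) : ∃ j, q ∈ chart k N j := by
  have h := Proj.iSup_basicOpen_eq_top' (grading k N)
    (fun j : Fin (N + 1) ↦ (MvPolynomial.X j : MvPolynomial (Fin (N + 1)) k))
    (fun j ↦ ⟨1, X_mem k N j⟩) <| by
      refine top_le_iff.1 fun p _ ↦ ?_
      induction p using MvPolynomial.induction_on with
      | C a => exact Subalgebra.algebraMap_mem _ (algebraMap k (grading k N 0) a)
      | add p q hp hq => exact add_mem (hp trivial) (hq trivial)
      | mul_X p i hp => exact mul_mem (hp trivial) (Algebra.subset_adjoin ⟨i, rfl⟩)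
  have : q ∈ (⊤ : (ProjSpace k N).Opens) := trivial
  rw [← h, Opens.mem_iSup] at this
  exact this

/-- Multiplication by the coordinate `x_j`, as a linear map `H^0(M(n)) → H^0(M(n + 1))`. -/
def mulCoordH0 (j : Fin (N + 1)) (n : ℕ) :
    H0 (serreTwist M (n : ℤ)) →ₗ[k] H0 (serreTwist M ((n + 1 : ℕ) : ℤ)) :=
  (mulH0 M (n : ℤ) 1).flip (coordSection k N j ⊤)

theorem mulCoordH0_comm (i j : Fin (N + 1)) (n : ℕ) (s : H0 (serreTwist M (n : ℤ))) :
    mulCoordH0 M i (n + 1) (mulCoordH0 M j n s) = mulCoordH0 M j (n + 1) (mulCoordH0 M i n s) :=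
  twist_ext (M := M) _ _ fun _ ↦ smul_comm _ _ _

variable {M}

theorem iSup_range_mulCoordH0 (hreg : IsCastelnuovoMumfordRegular M) (n : ℕ) :
    ⨆ j, LinearMap.range (mulCoordH0 M j n) = ⊤ := by
  refine top_le_iff.1 fun s _ ↦ ?_
  obtain ⟨t, ht⟩ := exists_sum_eq (T := twistSheaf M) (x := fun j _ _ h ↦ mulCoord M j h)
    (fun i j _ _ _ h h' ↦ mulCoord_comm M i j h h')
    (fun q ↦ (exists_mem_chart q).imp fun j hj ↦
      ⟨chart k N j, hj, fun V hV a b h ↦ mulCoord_bijective M j h hV⟩)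
    hreg n (b := ((n + 1 : ℕ) : ℤ)) (by simp) s
  rw [← ht]
  exact sum_mem fun j _ ↦ Submodule.mem_iSup_of_mem j ⟨t j, rfl⟩

theorem iSup_map_mulCoordH0_le (d : ℕ) (V : Submodule k (H0 (serreTwist M (d : ℤ)))) :
    ⨆ j, V.map (mulCoordH0 M j d) ≤ mulByLinear M (d : ℤ) V := by
  refine iSup_le fun j ↦ ?_
  rintro _ ⟨v, hv, rfl⟩
  exact Submodule.apply_mem_map₂ (mulH0 M (d : ℤ) 1) hv Submodule.mem_top

end Coordinates

end

end CMReg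

theorem theorem3 {k : Type u} [Field k] (N : ℕ) (M : (CMReg.ProjSpace k N).Modules)
    (hM : CMReg.IsCoherent M) (hreg : CMReg.IsCastelnuovoMumfordRegular M)
    (d : ℕ) (hd : 1 ≤ d) (c : ℕ)
    (V : Submodule k (CMReg.H0 (CMReg.serreTwist M (d : ℤ))))
    (hV : Module.rank k (CMReg.H0 (CMReg.serreTwist M (d : ℤ)) ⧸ V) = (c : Cardinal.{u})) :
    Module.rank k
        (CMReg.H0 (CMReg.serreTwist M ((d : ℤ) + 1)) ⧸ CMReg.mulByLinear M (d : ℤ) V) ≤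
      (CMReg.macaulayBound c d : Cardinal.{u}) := by
  have h := CMReg.rank_quotient_le_macaulayBound (F := fun n : ℕ ↦ CMReg.H0 (CMReg.serreTwist M (n : ℤ)))
    (CMReg.mulCoordH0_comm M) (CMReg.iSup_range_mulCoordH0 hreg) hd V hV.le
  -- The quotient by V^{d+1} is a quotient of that by ∑ x_j V; equality of the two subspaces is not
  -- needed.
  exact ((Submodule.factor (CMReg.iSup_map_mulCoordH0_le d V)).rank_le_of_surjective
    (Submodule.factor_surjective _)).trans h
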